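/- An infinite periodic frieze is an array of integers with infinitely many rows, consisting of a row of $0$'s, then a row of $1$'s, then rows of positive integers, each row shifted by half a step against the previous one, such that every diamond with left, right, top and bottom entries $a,d,b,c$ satisfies $ad-bc=1$, and whose third row (the quiddity row) is periodic. A quiddity sequence of the frieze is a tuple of consecutive entries of the quiddity row over one (not necessarily minimal) period. Quiddity sequences are considered up to cyclic rotation, and friezes up to horizontal translation. A frieze is skeletal if its quiddity row contains no $1$ and is not constantly equal to $2$. A triangulation of an annulus with $m\ge 1$ marked points on the outer and $n\ge 1$ marked points on the inner boundary component is a maximal collection of pairwise compatible (finite) arcs between marked points; arcs are taken up to homotopy, have no self-intersections, and are not homotopic to a point or to a boundary segment between neighbouring marked points. Two infinite periodic friezes $(\mathcal F_1,\mathcal F_2)$ form the pair of friezes of such a triangulation if the numbers of triangles at the marked points of the outer, respectively inner, boundary component, both read in the same direction around the annulus, form quiddity sequences of $\mathcal F_1$, respectively $\mathcal F_2$. (A triangle is counted at a marked point as often as it has corners there.) A reduction of a cyclic sequence $(a_1,\dots,a_r)$ of positive integers at an entry $a_i=1$ deletes $a_i$ and lowers both neighbours by $1$, if $r\ge 3$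 and both neighbours are at least $2$; for $r=2$ it replaces $(1,k)$, $k\ge 3$, by $(k-2)$. A reverse reduction is the inverse operation. Theorem. Let $\mathcal F_1^s$ be a skeletal infinite periodic frieze. (1) There is, up to translation, exactly one skeletal infinite periodic frieze $\mathcal F_2^s$ such that $(\mathcal F_1^s,\mathcal F_2^s)$ is the pair of friezes of a triangulation of an annulus. (2) Every infinite periodic frieze $\mathcal F_2$ that has a quiddity sequence obtained from a quiddity sequence of $\mathcal F_2^s$ by one or more reverse reductions forms with $\mathcal F_1^s$ the pair $(\mathcal F_1^s,\mathcal F_2)$ of friezes of a triangulation of an annulus, and up to translation there are infinitely many such friezes $\mathcal F_2$. -/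

import Mathlib

/-- An infinite periodic frieze. Row `0` consists of zeros, row `1` of ones, row `2` is the
quiddity row, all entries below the row of zeros are positive integers, and every diamond with
left entry `entry (k+1) i`, right entry `entry (k+1) (i+1)`, top entry `entry k (i+1)` and
bottom entry `entry (k+2) i` satisfies the determinant rule `left * right - top * bottom = 1`.
(In the usual two-index notation, `entry k i` is `a_{i, i+k-2}`.) -/
structure PeriodicFrieze where
  entry : ℕ → ℤ → ℕ
  row_zero : ∀ i, entry 0 i = 0
  row_one : ∀ i, entry 1 i = 1
  entry_pos : ∀ k i, 1 ≤ k → 0 < entry k i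
  diamond : ∀ k i,
    entry (k + 1) i * entry (k + 1) (i + 1) = entry k (i + 1) * entry (k + 2) i + 1
  periodic : ∃ n : ℕ, 0 < n ∧ ∀ i, entry 2 (i + n) = entry 2 i

namespace PeriodicFrieze

/-- The quiddity row of a frieze: its first non-trivial row. -/
def quiddityRow (F : PeriodicFrieze) (i : ℤ) : ℕ := F.entry 2 i

/-- `q` is a quiddity sequence of `F`: it lists the entries of the quiddity row over one
period (not necessarily a minimal one), with an arbitrary starting position. -/
def IsQuidditySequence (F : PeriodicFrieze) (q : List ℕ) : Prop :=
  ∃ n : ℕ, 0 < n ∧ (∀ i, F.quiddityRow (i + n) = F.quiddityRow i) ∧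
    ∃ s : ℤ, q = (List.range n).map fun k => F.quiddityRow (s + k)

/-- A skeletal frieze: there are no `1`s in the quiddity row, and not all of it is `2`. -/
def IsSkeletal (F : PeriodicFrieze) : Prop :=
  (∀ i, F.quiddityRow i ≠ 1) ∧ ∃ i, F.quiddityRow i ≠ 2

/-- Two friezes that differ by a horizontal translation only. Since quiddity sequences are taken
up to cyclic equivalence, such friezes are considered to be the same. -/
def Translate (F G : PeriodicFrieze) : Prop :=
  ∃ s : ℤ, ∀ k i, G.entry k i = F.entry k (i + s)

/-- Friezes up to horizontal translation. -/
instance translateSetoid : Setoid PeriodicFrieze where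
  r := Translate
  iseqv :=
    { refl := fun F => ⟨0, fun k i => by simp⟩
      symm := by
        rintro F G ⟨s, h⟩
        exact ⟨-s, fun k i => by rw [h]; simp⟩
      trans := by
        rintro F G H ⟨s, h⟩ ⟨t, h'⟩
        exact ⟨t + s, fun k i => by rw [h', h, add_assoc]⟩ }

end PeriodicFrieze

/-- `IsReduction q q'`: the cyclic sequence `q'` is obtained from the cyclic sequence `q` by one
reduction at an entry `1`; equivalently, `q` is obtained from `q'` by one reverse reduction.
Either `q` has length at least three, both neighbours of the `1` are at least `2`, the `1` is
deleted and both neighbours are lowered by `1`; or `q = (1, k)` with `k ≥ 3` and `q' = (k - 2)`. -/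
def IsReduction (q q' : List ℕ) : Prop :=
  (∃ (x y : ℕ) (l : List ℕ), 2 ≤ x ∧ 2 ≤ y ∧
      q ~r (x :: 1 :: y :: l) ∧ q' ~r ((x - 1) :: (y - 1) :: l)) ∨
  (∃ k : ℕ, 3 ≤ k ∧ q ~r [1, k] ∧ q' = [k - 2])

namespace PeriodicFrieze

/-- `G` is obtained from `F` by reverse reductions: some quiddity sequence of `G` arises from some
quiddity sequence of `F` by one or more successive reverse reductions. -/
def IsReverseReductionOf (G F : PeriodicFrieze) : Prop :=
  ∃ q p : List ℕ, G.IsQuidditySequence q ∧ F.IsQuidditySequence p ∧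
    Relation.TransGen IsReduction q p

end PeriodicFrieze

namespace Annulus

/-- The marked points in the universal cover of an annulus with marked points. The universal
cover is a strip; the marked points on its lower side (covering the outer boundary component) and
on its upper side (covering the inner boundary component) are numbered by `ℤ` from left to right.
The linear order is the one in which the boundary of the strip is traversed: first the lower side
from left to right, then the upper side from right to left. -/
abbrev CoverPoint : Type := Lex (ℤ ⊕ ℤᵒᵈ)

/-- The marked point number `i` on the lower side of the strip (over the outer boundary). -/
def outer (i : ℤ) : CoverPoint := toLex (Sum.inl i)

/-- The marked point number `j` on the upper side of the strip (over the inner boundary). -/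
def inner (j : ℤ) : CoverPoint := toLex (Sum.inr (OrderDual.toDual j))

/-- The deck transformation number `k` of the universal cover of the annulus with `m` marked
points on the outer and `n` marked points on the inner boundary component. -/
def deck (m n : ℕ) (k : ℤ) (p : CoverPoint) : CoverPoint :=
  match ofLex p with
  | Sum.inl i => outer (i + k * m)
  | Sum.inr j => inner (OrderDual.ofDual j + k * n)

/-- A curve in the strip between two marked points, up to homotopy with fixed endpoints. As the
strip is simply connected, it is given by its two endpoints; they are listed in increasing
order. -/
abbrev Chord : Type := CoverPoint × CoverPoint

/-- The image of a curve under a deck transformation. -/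
def deckChord (m n : ℕ) (k : ℤ) (c : Chord) : Chord := (deck m n k c.1, deck m n k c.2)

/-- Two curves in the strip cross if their endpoints are linked on the boundary of the strip, that
is, if every two curves with these endpoints meet in an inner point. -/
def Crosses (c d : Chord) : Prop :=
  (c.1 < d.1 ∧ d.1 < c.2 ∧ c.2 < d.2) ∨ (d.1 < c.1 ∧ c.1 < d.2 ∧ d.2 < c.2)

/-- `c` is a lift of an arc of the annulus: its endpoints are distinct (the arc is not
contractible to a point), they are not neighbours on the same side (the arc is not homotopic to a
boundary segment), and `c` crosses none of its own translates (the arc has a representative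
without self-intersections). Arcs of the annulus, up to homotopy, correspond to such lifts up to
deck transformations. -/
def IsArc (m n : ℕ) (c : Chord) : Prop :=
  c.1 < c.2 ∧ ¬ c.1 ⋖ c.2 ∧ ∀ k : ℤ, ¬ Crosses c (deckChord m n k c)

/-- A triangulation of the annulus with `m` and `n` marked points on its boundary components: a
maximal collection of pairwise compatible arcs. It is given by the set of all lifts of its arcs
to the strip. -/
structure Triangulation (m n : ℕ) where
  arcs : Set Chord
  isArc : ∀ c ∈ arcs, IsArc m n c
  deck_mem : ∀ c ∈ arcs, ∀ k : ℤ, deckChord m n k c ∈ arcs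
  compatible : ∀ c ∈ arcs, ∀ d ∈ arcs, ¬ Crosses c d
  maximal : ∀ c, IsArc m n c → (∀ d ∈ arcs, ¬ Crosses c d) → c ∈ arcs

namespace Triangulation

variable {m n : ℕ}

/-- The points `a < b` of the strip are joined by a boundary segment or by a lift of an arc. -/
def Joined (T : Triangulation m n) (a b : CoverPoint) : Prop :=
  a ⋖ b ∨ (a, b) ∈ T.arcs

/-- The triangles, in the strip, of the triangulation, with their corners in increasing order. -/
def triangles (T : Triangulation m n) : Set (CoverPoint × CoverPoint × CoverPoint) :=
  {t | t.1 < t.2.1 ∧ t.2.1 < t.2.2 ∧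
    T.Joined t.1 t.2.1 ∧ T.Joined t.2.1 t.2.2 ∧ T.Joined t.1 t.2.2}

/-- The number of triangles at a marked point. It is counted at a lift of the marked point, so
that a triangle of the annulus several of whose corners lie at the marked point is counted once
for each of these corners. -/
noncomputable def numTriangles (T : Triangulation m n) (p : CoverPoint) : ℕ∞ :=
  {t ∈ T.triangles | p = t.1 ∨ p = t.2.1 ∨ p = t.2.2}.encard

end Triangulation

/-- `(F₁, F₂)` is the pair of friezes of a triangulation of an annulus: the quiddity rows are the
numbers of triangles at the marked points on the outer and on the inner boundary component, both
read in the same direction around the annulus. -/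
def IsFriezePair (F₁ F₂ : PeriodicFrieze) : Prop :=
  ∃ (m n : ℕ) (_ : 0 < m) (_ : 0 < n) (T : Triangulation m n),
    (∀ i, T.numTriangles (outer i) = F₁.quiddityRow i) ∧
    (∀ j, T.numTriangles (inner j) = F₂.quiddityRow j)

end Annulus

/-! A triangulation all of whose arcs bridge the two boundary components is a staircase: in the
strip, the outer point `i` is joined exactly to the inner points `J (i - 1), ..., J i`, for a
monotone `J` with `J (i + m) = J i + n`. Its outer counts are `2 + J i - J (i - 1)`. By symmetry its
inner counts are `2 + L (j + 1) - L j`, where `L` is the lower adjoint of `J`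
(`numTriangles_outer_of_ladder`, `numTriangles_inner_of_ladder`).

A skeletal quiddity row has entries at least `2`, not all `2`, so summing `a_i - 2` gives such a
`J`, unique up to a constant. Changing the constant only shifts `L`, so the partner row `upperRow L`
is determined up to translation. Uniqueness among all triangulations holds because a peripheral arc
cuts off a marked point with a single triangle, that is, an entry `1`
(`Triangulation.exists_numTriangles_eq_one`, `Triangulation.exists_arcs_eq_ladder`).

A reverse reduction on the inner side glues a triangle onto a boundary segment and leaves the outer
counts alone (`EarInsertion`, `IsPartner.insertion`). That the resulting rows belong to friezes
follows from a positive supersolution of the frieze recursion (`continuant_pos`), which survives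
insertions. Reverse reductions make entries arbitrarily large, whereas finitely many friezes have
only finitely many entries in their quiddity rows. -/

namespace PeriodicFrieze

/-! ### Friezes and their quiddity rows -/

theorem entry_eq_of_quiddityRow_eq {F G : PeriodicFrieze} {s : ℤ}
    (h : ∀ i, G.quiddityRow i = F.quiddityRow (i + s)) (k : ℕ) :
    (∀ i, G.entry k i = F.entry k (i + s)) ∧ ∀ i, G.entry (k + 1) i = F.entry (k + 1) (i + s) := by
  induction k with
  | zero => exact ⟨fun i => by rw [G.row_zero, F.row_zero], fun i => by rw [G.row_one, F.row_one]⟩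
  | succ k ih =>
    refine ⟨ih.2, fun i => ?_⟩
    -- The diamond rule yields the bottom entry only when the top entry is nonzero; under the row of
    -- zeros the hypothesis on the quiddity rows takes over.
    rcases Nat.eq_zero_or_pos k with rfl | hk
    · exact h i
    · have hG := G.diamond k i
      have hF := F.diamond k (i + s)
      rw [ih.2, ih.2, ih.1, add_right_comm i 1 s, hF] at hG
      exact (Nat.eq_of_mul_eq_mul_left (F.entry_pos k _ hk) (Nat.succ_injective hG)).symm

theorem translate_of_quiddityRow_eq {F G : PeriodicFrieze} {s : ℤ}
    (h : ∀ i, G.quiddityRow i = F.quiddityRow (i + s)) : F.Translate G :=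
  ⟨s, fun k => (entry_eq_of_quiddityRow_eq h k).1⟩

/-- The entries of the (integral) frieze with quiddity row `a`. -/
def continuant (a : ℤ → ℕ) : ℕ → ℤ → ℤ
  | 0, _ => 0
  | 1, _ => 1
  | k + 2, i => a (i + k) * continuant a (k + 1) i - continuant a k i

theorem continuant_diamond (a : ℤ → ℕ) (k : ℕ) (i : ℤ) :
    continuant a (k + 1) i * continuant a (k + 1) (i + 1) =
      continuant a k (i + 1) * continuant a (k + 2) i + 1 := by
  induction k with
  | zero => simp [continuant]
  | succ k ih =>
    have h1 : continuant a (k + 1 + 2) i =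
      a (i + (k + 1)) * continuant a (k + 2) i - continuant a (k + 1) i := by
      simp [continuant]
    have h2 : continuant a (k + 1 + 1) (i + 1) =
      a (i + (k + 1)) * continuant a (k + 1) (i + 1) - continuant a k (i + 1) := by
      rw [continuant, add_assoc, add_comm (1 : ℤ)]
    rw [h1, h2]
    linear_combination ih

/-- A positive supersolution of `v (i - 1) + v (i + 1) = a i * v i`. -/
def IsSupersolution (a : ℤ → ℕ) (v : ℤ → ℤ) : Prop :=
  (∀ i, 0 < v i) ∧ ∀ i, v (i - 1) + v (i + 1) ≤ a i * v i

/-- Sturm comparison: the supersolution inequality makes the discrete Wronskian of the continuant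
and `v` nondecreasing in `k`, and it starts at `v (i - 1) > 0`. Its positivity forces the next
continuant to be positive. -/
theorem continuant_pos {a : ℤ → ℕ} {v : ℤ → ℤ} (h : IsSupersolution a v) (k : ℕ) (i : ℤ) :
    0 < continuant a (k + 1) i ∧
      0 < continuant a (k + 1) i * v (i + k - 1) - continuant a k i * v (i + k) := by
  induction k with
  | zero => simpa [continuant] using h.1 _
  | succ k ih =>
    obtain ⟨h1, h2⟩ := ih
    have h3 := h.2 (i + k)
    have h4 : 0 < continuant a (k + 1 + 1) i * v (i + (k + 1 : ℕ) - 1) -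
        continuant a (k + 1) i * v (i + (k + 1 : ℕ)) := by
      push_cast
      rw [← add_assoc, add_sub_cancel_right]
      have h5 := mul_le_mul_of_nonneg_left h3 h1.le
      rw [continuant]
      linarith
    refine ⟨pos_of_mul_pos_left (b := v (i + (k + 1 : ℕ) - 1)) ?_ (h.1 _).le, h4⟩
    have := mul_pos h1 (h.1 (i + (k + 1 : ℕ)))
    linarith

theorem exists_of_isSupersolution {a : ℤ → ℕ} {n : ℕ} (hn : 0 < n) (ha : ∀ i, a (i + n) = a i)
    {v : ℤ → ℤ} (h : IsSupersolution a v) : ∃ F : PeriodicFrieze, F.quiddityRow = a := by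
  have nonneg : ∀ k i, 0 ≤ continuant a k i
    | 0, _ => le_rfl
    | k + 1, i => (continuant_pos h k i).1.le
  have two : ∀ i, (continuant a 2 i).toNat = a i := fun i => by simp [continuant]
  refine ⟨{ entry := fun k i => (continuant a k i).toNat
            row_zero := fun i => by simp [continuant]
            row_one := fun i => by simp [continuant]
            entry_pos := ?_
            diamond := ?_
            periodic := ⟨n, hn, fun i => by rw [two, two, ha]⟩ }, funext two⟩
  · intro k i hk
    obtain ⟨k, rfl⟩ := Nat.exists_eq_add_of_le' hk
    simpa using (continuant_pos h k i).1
  · intro k i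
    zify
    simp only [Int.toNat_of_nonneg (nonneg _ _)]
    exact continuant_diamond a k i

end PeriodicFrieze

/-! ### Reverse reductions as insertions into periodic sequences -/

/-- The periodic extension of a cyclic sequence. -/
def List.periodicExt (q : List ℕ) (i : ℤ) : ℕ := q.getD (i % q.length).toNat 0

namespace List

theorem periodicExt_rotate (q : List ℕ) (k : ℕ) (i : ℤ) :
    (q.rotate k).periodicExt i = q.periodicExt (i + k) := by
  rcases eq_or_ne q [] with rfl | hq
  · simp [periodicExt]
  · have hpos : (0 : ℤ) < q.length := by exact_mod_cast length_pos_iff.2 hq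
    have hmod (j : ℤ) : (j % q.length).toNat < q.length := by
      have := Int.emod_lt_of_pos j hpos
      have := Int.emod_nonneg j hpos.ne'
      omega
    unfold periodicExt
    rw [length_rotate, getD_eq_getElem _ _ (by rw [length_rotate]; exact hmod i),
      getD_eq_getElem _ _ (hmod _), getElem_rotate]
    congr 1
    zify
    rw [Int.toNat_of_nonneg (Int.emod_nonneg _ hpos.ne'),
      Int.toNat_of_nonneg (Int.emod_nonneg _ hpos.ne'), Int.emod_add_emod]

theorem periodicExt_add_length (q : List ℕ) (i : ℤ) :
    q.periodicExt (i + q.length) = q.periodicExt i := by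
  simp [periodicExt]

theorem periodicExt_map_range {f : ℤ → ℕ} {n : ℕ} (hn : 0 < n) (hf : ∀ i, f (i + n) = f i)
    (i : ℤ) : ((range n).map fun k : ℕ => f k).periodicExt i = f i := by
  have h0 := Int.emod_nonneg i (b := n) (by omega)
  have h1 := Int.emod_lt_of_pos i (b := n) (by omega)
  unfold periodicExt
  rw [getD_eq_getElem _ _ (by simp; omega)]
  simp only [length_map, length_range, getElem_map, getElem_range, Int.toNat_of_nonneg h0]
  have : Function.Periodic f n := hf
  conv_rhs => rw [← Int.emod_add_mul_ediv i n, mul_comm]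
  exact (this.int_mul _ _).symm

theorem periodicExt_mul_add (q : List ℕ) (k : ℤ) {r : ℕ} (hr : r < q.length) {N : ℤ}
    (hN : N = q.length) : q.periodicExt (N * k + r) = q[r] := by
  have : (N * k + r) % q.length = r := by
    rw [hN, add_comm, Int.add_mul_emod_self_left]
    exact Int.emod_eq_of_lt (by omega) (by omega)
  unfold periodicExt
  rw [this, Int.toNat_natCast, getD_eq_getElem _ _ hr]

end List

/-- `c` arises from the `n`-periodic sequence `b` by inserting an entry `1` between the last entry
of every period and the first entry of the next one, and raising the neighbours by `1`. -/
def IsInsertion (n : ℕ) (b c : ℤ → ℕ) : Prop :=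
  (∀ k : ℤ, c ((n + 1) * k + n) = 1) ∧
  ∀ (k : ℤ) (r : ℕ), r < n → c ((n + 1) * k + r) =
    b (n * k + r) + ((if r = 0 then 1 else 0) + (if r + 1 = n then 1 else 0))

/-- In a period of length one the only entry is both neighbours of the new `1`, so it is raised
twice; this is the reduction rule for `(1, k)`. -/
theorem isInsertion_singleton (x : ℕ) :
    IsInsertion 1 [x].periodicExt [x + 2, 1].periodicExt := by
  refine ⟨fun k => ?_, fun k r hr => ?_⟩
  · rw [List.periodicExt_mul_add _ _ (by simp) (by simp)]
    simp
  · obtain rfl : r = 0 := by omega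
    rw [List.periodicExt_mul_add _ _ (by simp) (by simp),
      List.periodicExt_mul_add _ _ (by simp) (by simp)]
    simp

/-- The sequences are rotated so that the new `1` closes the period, as `IsInsertion` requires. -/
theorem isInsertion_cons_append (x y : ℕ) (l : List ℕ) :
    IsInsertion (l.length + 2) (y :: (l ++ [x])).periodicExt
      ((y + 1) :: (l ++ [x + 1, 1])).periodicExt := by
  refine ⟨fun k => ?_, fun k r hr => ?_⟩
  · rw [List.periodicExt_mul_add _ _ (by simp) (by simp)]
    simp
  · rw [List.periodicExt_mul_add _ _ (by simp; omega) (by simp [add_assoc, one_add_one_eq_two]),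
      List.periodicExt_mul_add _ _ (by simp; omega) (by simp [add_assoc, one_add_one_eq_two])]
    rcases r with _ | r
    · simp
    · rcases Nat.lt_or_ge r l.length with h | h
      · have : r + 1 + 1 ≠ l.length + 2 := by omega
        simp [h, List.getElem_append_left]; omega
      · obtain rfl : r = l.length := by omega
        simp

/-- A property of periodic sequences that is invariant under shifts and insertions is inherited
under reverse reductions. -/
theorem IsReduction.induct {Φ : ℕ → (ℤ → ℕ) → Prop}
    (shift : ∀ n b (s : ℤ), Φ n b → Φ n fun i => b (i + s))
    (ins : ∀ n b c, 0 < n → IsInsertion n b c → Φ n b → Φ (n + 1) c)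
    {q q' : List ℕ} (h : IsReduction q q') (hq' : Φ q'.length q'.periodicExt) :
    Φ q.length q.periodicExt := by
  have rot : ∀ {p p' : List ℕ}, p ~r p' → Φ p.length p.periodicExt →
      Φ p'.length p'.periodicExt := by
    rintro p _ ⟨k, rfl⟩ hp
    rw [List.length_rotate, funext (List.periodicExt_rotate p k)]
    exact shift _ _ _ hp
  rcases h with ⟨x, y, l, hx, hy, hq, hq1⟩ | ⟨k, hk, hq, rfl⟩
  · obtain ⟨x, rfl⟩ := Nat.exists_eq_add_of_le' (Nat.le_of_succ_le hx)
    obtain ⟨y, rfl⟩ := Nat.exists_eq_add_of_le' (Nat.le_of_succ_le hy)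
    have h1 : q' ~r (y :: (l ++ [x])) := hq1.trans ⟨1, by simp⟩
    have h2 : q ~r ((y + 1) :: (l ++ [x + 1, 1])) := hq.trans ⟨2, by simp⟩
    refine rot h2.symm ?_
    have := ins _ _ _ (by omega) (isInsertion_cons_append x y l) (by simpa using rot h1 hq')
    simpa using this
  · obtain ⟨k, rfl⟩ := Nat.exists_eq_add_of_le' (Nat.le_of_succ_le hk)
    have h2 : q ~r [k + 2, 1] := hq.trans ⟨1, by simp⟩
    exact rot h2.symm (ins _ _ _ one_pos (isInsertion_singleton k) hq')

theorem IsReduction.transGen_induct {Φ : ℕ → (ℤ → ℕ) → Prop}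
    (shift : ∀ n b (s : ℤ), Φ n b → Φ n fun i => b (i + s))
    (ins : ∀ n b c, 0 < n → IsInsertion n b c → Φ n b → Φ (n + 1) c)
    {q q' : List ℕ} (h : Relation.TransGen IsReduction q q')
    (hq' : Φ q'.length q'.periodicExt) : Φ q.length q.periodicExt := by
  induction h using Relation.TransGen.head_induction_on with
  | single h => exact h.induct shift ins hq'
  | head h _ ih => exact h.induct shift ins ih

theorem exists_mul_add (n : ℕ) (t : ℤ) : ∃ (k : ℤ) (r : ℕ), r ≤ n ∧ t = (n + 1) * k + r := by
  have h0 := Int.emod_nonneg t (b := n + 1) (by omega)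
  have h1 := Int.emod_lt_of_pos t (b := n + 1) (by omega)
  refine ⟨t / (n + 1), (t % (n + 1)).toNat, by omega, ?_⟩
  rw [Int.toNat_of_nonneg h0, Int.mul_ediv_add_emod]

/-- The new position receives the sum of the values at its neighbours. This gives equality at the
entry `1`; at a neighbour, the left side grows by the value there, which the raised entry
compensates. -/
theorem PeriodicFrieze.IsSupersolution.exists_of_isInsertion {n : ℕ} {b c : ℤ → ℕ} (hn : 0 < n)
    (h : IsInsertion n b c) (hb : ∃ v, IsSupersolution b v) : ∃ v, IsSupersolution c v := by
  obtain ⟨v, hv, hs⟩ := hb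
  -- For `t = (n + 1) * k + r` the index `t - t / (n + 1)` equals `n * k + r`. At `r = n` this is
  -- the old right neighbour of the new entry, and one less is the old left neighbour.
  let w : ℤ → ℤ := fun t => v (t - t / (n + 1)) +
    if t % (n + 1) = n then v (t - t / (n + 1) - 1) else 0
  have hdiv (k : ℤ) {r : ℤ} (h0 : 0 ≤ r) (h1 : r ≤ n) : ((n + 1) * k + r) / (n + 1 : ℤ) = k := by
    rw [add_comm, Int.add_mul_ediv_left _ _ (by omega), Int.ediv_eq_zero_of_lt h0 (by omega)]
    simp
  have hmod (k : ℤ) {r : ℤ} (h0 : 0 ≤ r) (h1 : r ≤ n) : ((n + 1) * k + r) % (n + 1 : ℤ) = r := by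
    rw [add_comm, Int.add_mul_emod_self_left, Int.emod_eq_of_lt h0 (by omega)]
  have w_old (k r : ℤ) (h0 : 0 ≤ r) (h1 : r < n) : w ((n + 1) * k + r) = v (n * k + r) := by
    simp only [w, hdiv k h0 h1.le, hmod k h0 h1.le, if_neg h1.ne, add_zero]
    congr 1; ring
  have w_new (k : ℤ) : w ((n + 1) * k + n) = v (n * k + n) + v (n * k + n - 1) := by
    simp only [w, hdiv k (Int.natCast_nonneg n) le_rfl, hmod k (Int.natCast_nonneg n) le_rfl,
      if_true]
    congr 2 <;> ring
  refine ⟨w, fun t => ?_, fun t => ?_⟩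
  · have := hv (t - t / (n + 1))
    have := hv (t - t / (n + 1) - 1)
    simp only [w]
    split_ifs <;> omega
  · obtain ⟨k, r, hr, rfl⟩ := exists_mul_add n t
    rcases hr.eq_or_lt with rfl | hr
    · have e1 : ((r + 1) * k + r - 1 : ℤ) = (r + 1) * k + (r - 1) := by ring
      have e2 : ((r + 1) * k + r + 1 : ℤ) = (r + 1) * (k + 1) + 0 := by ring
      have e3 : (r * (k + 1) + 0 : ℤ) = r * k + r := by ring
      rw [e1, e2, w_old k _ (by omega) (by omega), w_old _ _ le_rfl (by omega), w_new, h.1, e3,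
        ← add_sub_assoc]
      push_cast
      linarith
    · have hc := h.2 k r hr
      have hle := hs (n * k + r)
      have right : w ((n + 1) * k + r + 1) =
          v (n * k + r + 1) + if r + 1 = n then v (n * k + r) else 0 := by
        rw [add_assoc, add_assoc]
        split_ifs with hrn
        · have : (r + 1 : ℤ) = n := by omega
          rw [this, w_new, ← this, ← add_assoc, add_sub_cancel_right]
        · rw [w_old _ _ (by omega) (by omega), add_zero]
      have left : w ((n + 1) * k + r - 1) =
          v (n * k + r - 1) + if r = 0 then v (n * k + r) else 0 := by
        split_ifs with hr0
        · subst hr0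
          have e1 : ((n + 1) * k + (0 : ℕ) - 1 : ℤ) = (n + 1) * (k - 1) + n := by push_cast; ring
          have e2 : (n * (k - 1) + n : ℤ) = n * k + (0 : ℕ) := by push_cast; ring
          rw [e1, w_new, e2, add_comm]
        · rw [add_sub_assoc, add_sub_assoc, w_old _ _ (by omega) (by omega), add_zero]
      rw [left, right, w_old k r (by omega) (by omega), hc]
      push_cast
      split_ifs <;> linarith

/-! ### Ladders: triangulations by bridging arcs -/

namespace Annulus

theorem CoverPoint.cases (p : CoverPoint) : (∃ i, p = outer i) ∨ ∃ j, p = inner j := by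
  rcases h : ofLex p with i | j
  · exact Or.inl ⟨i, by rw [outer, ← h, toLex_ofLex]⟩
  · exact Or.inr ⟨OrderDual.ofDual j, by rw [inner, OrderDual.toDual_ofDual, ← h, toLex_ofLex]⟩

@[simp] theorem outer_lt_outer {i j : ℤ} : outer i < outer j ↔ i < j := by
  simp [outer]

@[simp] theorem inner_lt_inner {i j : ℤ} : inner i < inner j ↔ j < i := by
  simp [inner]

@[simp] theorem outer_lt_inner {i j : ℤ} : outer i < inner j := by
  simp [outer, inner]

@[simp] theorem not_inner_lt_outer {i j : ℤ} : ¬ inner i < outer j := by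
  simp [outer, inner]

@[simp] theorem outer_inj {i j : ℤ} : outer i = outer j ↔ i = j := by
  simp [outer]

@[simp] theorem inner_inj {i j : ℤ} : inner i = inner j ↔ i = j := by
  simp [inner]

@[simp] theorem outer_ne_inner {i j : ℤ} : outer i ≠ inner j := by
  simp [outer, inner]

@[simp] theorem inner_ne_outer {i j : ℤ} : inner i ≠ outer j := by
  simp [outer, inner]

@[simp] theorem outer_covBy_outer {i j : ℤ} : outer i ⋖ outer j ↔ j = i + 1 := by
  refine ⟨fun h => ?_, ?_⟩
  · have h1 := outer_lt_outer.1 h.1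
    have h2 : ¬ i + 1 < j := fun h3 =>
      h.2 (c := outer (i + 1)) (outer_lt_outer.2 (by omega)) (outer_lt_outer.2 h3)
    omega
  · rintro rfl
    refine ⟨by simp, fun c h1 h2 => ?_⟩
    rcases c.cases with ⟨k, rfl⟩ | ⟨k, rfl⟩
    · rw [outer_lt_outer] at h1 h2; omega
    · simp at h2

@[simp] theorem inner_covBy_inner {i j : ℤ} : inner i ⋖ inner j ↔ i = j + 1 := by
  refine ⟨fun h => ?_, ?_⟩
  · have h1 := inner_lt_inner.1 h.1
    have h2 : ¬ j + 1 < i := fun h3 =>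
      h.2 (c := inner (j + 1)) (inner_lt_inner.2 h3) (inner_lt_inner.2 (by omega))
    omega
  · rintro rfl
    refine ⟨by simp, fun c h1 h2 => ?_⟩
    rcases c.cases with ⟨k, rfl⟩ | ⟨k, rfl⟩
    · simp at h1
    · rw [inner_lt_inner] at h1 h2; omega

@[simp] theorem not_outer_covBy_inner {i j : ℤ} : ¬ outer i ⋖ inner j := fun h =>
  h.2 (c := outer (i + 1)) (by simp) (by simp)

@[simp] theorem not_inner_covBy_outer {i j : ℤ} : ¬ inner i ⋖ outer j := fun h => by
  simpa using h.1

@[simp] theorem deck_outer (m n : ℕ) (k i : ℤ) : deck m n k (outer i) = outer (i + k * m) := rfl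

@[simp] theorem deck_inner (m n : ℕ) (k j : ℤ) : deck m n k (inner j) = inner (j + k * n) := rfl

theorem crosses_comm {c d : Chord} : Crosses c d ↔ Crosses d c := or_comm

/-- Two bridging arcs cross if they are not compatible with the product order. -/
theorem crosses_bridging {i j i' j' : ℤ} :
    Crosses (outer i, inner j) (outer i', inner j') ↔ i < i' ∧ j' < j ∨ i' < i ∧ j < j' := by
  simp [Crosses]

/-- The bridging arcs `(i, j)` with `J (i - 1) ≤ j ≤ J i`. -/
def ladder (J : ℤ → ℤ) : Set Chord :=
  {c | ∃ i j, c = (outer i, inner j) ∧ J (i - 1) ≤ j ∧ j ≤ J i}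

section Ladder

variable {L J : ℤ → ℤ}

theorem mem_ladder {i j : ℤ} : (outer i, inner j) ∈ ladder J ↔ J (i - 1) ≤ j ∧ j ≤ J i := by
  constructor
  · rintro ⟨i', j', h, h'⟩
    simp only [Prod.mk.injEq, outer_inj, inner_inj] at h
    rwa [h.1, h.2]
  · exact fun h => ⟨i, j, rfl, h⟩

theorem ladder_not_crosses (hJ : Monotone J) {c d : Chord} (hc : c ∈ ladder J)
    (hd : d ∈ ladder J) : ¬ Crosses c d := by
  obtain ⟨i, j, rfl, h1, h2⟩ := hc
  obtain ⟨i', j', rfl, h3, h4⟩ := hd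
  rw [crosses_bridging]
  rintro (⟨h, h'⟩ | ⟨h, h'⟩)
  · have := hJ (show i ≤ i' - 1 by omega)
    omega
  · have := hJ (show i' ≤ i - 1 by omega)
    omega

/-- Every marked point carries a ladder arc: `(i, J i)` below and `(L j, j)` above. Such arcs cross
any peripheral chord that passes over their endpoint, and a bridging chord off the staircase crosses
one of its corner arcs. -/
theorem mem_ladder_of_maximal (hG : GaloisConnection L J) {c : Chord} (h1 : c.1 < c.2)
    (h2 : ¬ c.1 ⋖ c.2) (h : ∀ d ∈ ladder J, ¬ Crosses c d) : c ∈ ladder J := by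
  obtain ⟨p, q⟩ := c
  have succ_mem (i : ℤ) : (outer (i + 1), inner (J i)) ∈ ladder J :=
    mem_ladder.2 (by simpa using hG.monotone_u (show i ≤ i + 1 by omega))
  have self_mem (i : ℤ) : (outer i, inner (J i)) ∈ ladder J :=
    mem_ladder.2 ⟨hG.monotone_u (by omega), le_rfl⟩
  rcases p.cases with ⟨i, rfl⟩ | ⟨i, rfl⟩ <;> rcases q.cases with ⟨j, rfl⟩ | ⟨j, rfl⟩
  · simp only [outer_lt_outer, outer_covBy_outer] at h1 h2
    refine absurd (Or.inl ?_) (h _ (self_mem (i + 1)))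
    simp
    omega
  · refine mem_ladder.2 ⟨?_, ?_⟩ <;> by_contra hlt
    · exact h _ (self_mem (i - 1)) (crosses_bridging.2 (by omega))
    · exact h _ (succ_mem i) (crosses_bridging.2 (by omega))
  · simp at h1
  · simp only [inner_lt_inner, inner_covBy_inner] at h1 h2
    have hmem : (outer (L (j + 1)), inner (j + 1)) ∈ ladder J := by
      refine mem_ladder.2 ⟨?_, hG.le_u_l _⟩
      have := (hG (j + 1) (L (j + 1) - 1)).not.1 (by omega)
      omega
    refine absurd (Or.inr ?_) (h _ hmem)
    simp
    omega

theorem apply_add_mul {f : ℤ → ℤ} {m n : ℤ} (hf : ∀ i, f (i + m) = f i + n) (i k : ℤ) :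
    f (i + k * m) = f i + k * n := by
  induction k using Int.induction_on with
  | zero => simp
  | succ k ih => rw [add_one_mul, ← add_assoc, hf, ih]; ring
  | pred k ih =>
    have := hf (i + (-k - 1) * m)
    rw [show i + (-k - 1) * m + m = i + -k * m by ring, ih] at this
    linarith

theorem deckChord_mem_ladder {m n : ℕ} (hper : ∀ i, J (i + m) = J i + n) {c : Chord}
    (hc : c ∈ ladder J) (k : ℤ) : deckChord m n k c ∈ ladder J := by
  obtain ⟨i, j, rfl, h1, h2⟩ := hc
  change (outer (i + k * m), inner (j + k * n)) ∈ ladder J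
  rw [mem_ladder, show i + k * m - 1 = i - 1 + k * m by ring, apply_add_mul hper,
    apply_add_mul hper]
  exact ⟨by omega, by omega⟩

/-- The triangulation of the annulus whose arcs are the arcs of a ladder. -/
def Triangulation.ofLadder {m n : ℕ} (hG : GaloisConnection L J)
    (hper : ∀ i, J (i + m) = J i + n) : Triangulation m n where
  arcs := ladder J
  isArc c hc := by
    refine ⟨?_, ?_, fun k => ladder_not_crosses hG.monotone_u hc (deckChord_mem_ladder hper hc k)⟩
    all_goals obtain ⟨i, j, rfl, -⟩ := hc; simp
  deck_mem _ hc := deckChord_mem_ladder hper hc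
  compatible _ hc _ hd := ladder_not_crosses hG.monotone_u hc hd
  maximal _ hc := mem_ladder_of_maximal hG hc.1 hc.2.1

/-- The triangle of a ladder with two corners on the lower side. -/
def lowerTriangle (J : ℤ → ℤ) (i : ℤ) : CoverPoint × CoverPoint × CoverPoint :=
  (outer i, outer (i + 1), inner (J i))

/-- The triangle of a ladder with two corners on the upper side. -/
def upperTriangle (i j : ℤ) : CoverPoint × CoverPoint × CoverPoint :=
  (outer i, inner (j + 1), inner j)

variable {m n : ℕ} {T : Triangulation m n}

/-- Two corners of a triangle lie on one side and, without peripheral arcs, are neighbours there.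
For a lower segment, the fans of `i` and `i + 1` share only the point `J i`. -/
theorem mem_triangles_of_ladder (hT : T.arcs = ladder J) (hJ : Monotone J)
    {t : CoverPoint × CoverPoint × CoverPoint} : t ∈ T.triangles ↔
      (∃ i, t = lowerTriangle J i) ∨ ∃ i j, (J (i - 1) ≤ j ∧ j < J i) ∧ t = upperTriangle i j := by
  have hoo (i j) : (outer i, outer j) ∉ ladder J := by rintro ⟨_, _, h, -⟩; simp at h
  have hii (i j) : (inner i, inner j) ∉ ladder J := by rintro ⟨_, _, h, -⟩; simp at h
  constructor
  · obtain ⟨p, q, r⟩ := t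
    rintro ⟨h1, h2, h3, h4, h5⟩
    simp only [Triangulation.Joined, hT] at h1 h2 h3 h4 h5
    rcases p.cases with ⟨i, rfl⟩ | ⟨i, rfl⟩ <;> rcases q.cases with ⟨j, rfl⟩ | ⟨j, rfl⟩ <;>
      rcases r.cases with ⟨k, rfl⟩ | ⟨k, rfl⟩ <;>
      simp [hoo, hii, mem_ladder] at h1 h2 h3 h4 h5
    · omega
    · subst h3
      simp at h4
      left
      refine ⟨i, ?_⟩
      rw [lowerTriangle, le_antisymm h5.2 h4.1]
    · subst h4
      exact Or.inr ⟨i, k, ⟨h5.1, by omega⟩, rfl⟩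
    · omega
  · rintro (⟨i, rfl⟩ | ⟨i, j, h, rfl⟩)
    · have h1 := hJ (show i - 1 ≤ i by omega)
      have h2 := hJ (show i ≤ i + 1 by omega)
      simp [Triangulation.triangles, Triangulation.Joined, hT, lowerTriangle, mem_ladder, h1, h2]
    · simp [Triangulation.triangles, Triangulation.Joined, hT, upperTriangle, mem_ladder]
      omega

theorem encard_image_Ico {α : Type*} {f : ℤ → α} (hf : Function.Injective f) (a b : ℤ) :
    (f '' Set.Ico a b).encard = (b - a).toNat := by
  rw [hf.encard_image, ← Finset.coe_Ico, Set.encard_coe_eq_coe_finsetCard, Int.card_Ico]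

theorem lowerTriangle_injective : Function.Injective (lowerTriangle J) := fun i i' h => by
  simp only [lowerTriangle, Prod.mk.injEq, outer_inj] at h
  exact h.1

theorem upperTriangle_injective (i : ℤ) : Function.Injective (upperTriangle i) := fun j j' h => by
  simpa [upperTriangle] using h

theorem lowerTriangle_ne_upperTriangle {i i' j : ℤ} : lowerTriangle J i ≠ upperTriangle i' j := by
  simp [lowerTriangle, upperTriangle]

/-- Two triangles stand on the boundary segments next to the point; the others stand on the upper
segments spanned by its fan. -/
theorem numTriangles_outer_of_ladder (hT : T.arcs = ladder J) (hJ : Monotone J) (i : ℤ) :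
    T.numTriangles (outer i) = (2 + (J i - J (i - 1)).toNat : ℕ) := by
  have : {t ∈ T.triangles | outer i = t.1 ∨ outer i = t.2.1 ∨ outer i = t.2.2} =
      {lowerTriangle J (i - 1), lowerTriangle J i} ∪
        upperTriangle i '' Set.Ico (J (i - 1)) (J i) := by
    ext t
    simp only [Set.mem_ofPred_eq, mem_triangles_of_ladder hT hJ, Set.mem_union, Set.mem_insert_iff,
      Set.mem_singleton_iff, Set.mem_image, Set.mem_Ico]
    constructor
    · rintro ⟨⟨i', rfl⟩ | ⟨i', j, h, rfl⟩, h'⟩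
      · simp [lowerTriangle] at h'
        rcases h' with rfl | rfl <;> simp
      · simp [upperTriangle] at h'
        subst h'
        exact Or.inr ⟨j, h, rfl⟩
    · rintro ((rfl | rfl) | ⟨j, h, rfl⟩)
      · exact ⟨Or.inl ⟨_, rfl⟩, by simp [lowerTriangle]⟩
      · exact ⟨Or.inl ⟨_, rfl⟩, by simp [lowerTriangle]⟩
      · exact ⟨Or.inr ⟨_, _, h, rfl⟩, by simp [upperTriangle]⟩
  rw [Triangulation.numTriangles, this, Set.encard_union_eq, Set.encard_pair,
    encard_image_Ico (upperTriangle_injective i)]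
  · simp
  · exact fun h => by have := lowerTriangle_injective h; omega
  · rw [Set.disjoint_left]
    rintro _ (rfl | rfl) ⟨j, -, h⟩ <;> exact lowerTriangle_ne_upperTriangle h.symm

theorem numTriangles_inner_of_ladder (hT : T.arcs = ladder J) (hG : GaloisConnection L J) (j : ℤ) :
    T.numTriangles (inner j) = (2 + (L (j + 1) - L j).toNat : ℕ) := by
  have : {t ∈ T.triangles | inner j = t.1 ∨ inner j = t.2.1 ∨ inner j = t.2.2} =
      {upperTriangle (L j) (j - 1), upperTriangle (L (j + 1)) j} ∪
        lowerTriangle J '' Set.Ico (L j) (L (j + 1)) := by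
    ext t
    simp only [Set.mem_ofPred_eq, mem_triangles_of_ladder hT hG.monotone_u, Set.mem_union,
      Set.mem_insert_iff, Set.mem_singleton_iff, Set.mem_image, Set.mem_Ico]
    -- The adjunction locates the triangles at `j` through `L`: the upper segments ending at `j`
    -- have apexes `L j` and `L (j + 1)`, and the lower segments with apex `j` start at the `i` with
    -- `J i = j`.
    have key (i : ℤ) : (J (i - 1) < j ∧ j ≤ J i) ↔ i = L j := by
      have h1 := hG j i
      have h2 := hG j (i - 1)
      omega
    have key' (i : ℤ) : (J (i - 1) ≤ j ∧ j < J i) ↔ i = L (j + 1) := by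
      have h1 := hG (j + 1) i
      have h2 := hG (j + 1) (i - 1)
      omega
    have key'' (i : ℤ) : (L j ≤ i ∧ i < L (j + 1)) ↔ j = J i := by
      have h1 := hG j i
      have h2 := hG (j + 1) i
      omega
    constructor
    · rintro ⟨⟨i, rfl⟩ | ⟨i, j', h, rfl⟩, h'⟩
      · simp [lowerTriangle] at h'
        exact Or.inr ⟨i, (key'' i).2 h', rfl⟩
      · simp [upperTriangle] at h'
        rcases h' with rfl | rfl
        · left; left
          rw [(key i).1 (by omega), add_sub_cancel_right]
        · left; right
          rw [(key' i).1 h]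
    · rintro ((rfl | rfl) | ⟨i, h, rfl⟩)
      · have := (key (L j)).2 rfl
        exact ⟨Or.inr ⟨_, _, by omega, rfl⟩, by simp [upperTriangle]⟩
      · have := (key' (L (j + 1))).2 rfl
        exact ⟨Or.inr ⟨_, _, by omega, rfl⟩, by simp [upperTriangle]⟩
      · have := (key'' i).1 h
        exact ⟨Or.inl ⟨_, rfl⟩, by simp [lowerTriangle, this]⟩
  rw [Triangulation.numTriangles, this, Set.encard_union_eq, Set.encard_pair,
    encard_image_Ico lowerTriangle_injective]
  · simp
  · simp [upperTriangle]
  · rw [Set.disjoint_left]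
    rintro _ (rfl | rfl) ⟨i, -, h⟩ <;> exact lowerTriangle_ne_upperTriangle h

end Ladder

end Annulus

/-! ### Peripheral arcs, and triangulations without them -/

namespace Annulus

variable {m n : ℕ} {T : Triangulation m n}

/-- Below a peripheral arc there is a marked point with only one triangle. -/
theorem Triangulation.exists_numTriangles_eq_one {φ : ℤ → CoverPoint} (hφ : StrictMono φ)
    (hconv : ∀ i j p, φ i < p → p < φ j → ∃ l, p = φ l) {w : ℤ} (hw : w ≠ 0)
    (hdeck : ∀ k i, deck m n k (φ i) = φ (i + k * w)) (N : ℕ) :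
    ∀ i, (φ i, φ (i + N)) ∈ T.arcs → ∃ l, T.numTriangles (φ l) = 1 := by
  have hcov (i : ℤ) : φ i ⋖ φ (i + 1) := by
    refine ⟨hφ (by omega), fun p h1 h2 => ?_⟩
    obtain ⟨l, rfl⟩ := hconv _ _ _ h1 h2
    rw [hφ.lt_iff_lt] at h1 h2
    omega
  induction N using Nat.strong_induction_on with
  | _ N ih =>
    intro i harc
    obtain ⟨h1, h2, h3⟩ := T.isArc _ harc
    simp only [hφ.lt_iff_lt] at h1
    have hN : 2 ≤ N := by
      by_contra hlt
      obtain rfl : N = 1 := by omega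
      exact h2 (hcov i)
    -- An arc longer than one turn around the annulus would cross its own translate.
    have hNw : (N : ℤ) ≤ |w| := by
      by_contra hlt
      refine h3 w.sign (Or.inl ?_)
      simp only [deckChord, hdeck, hφ.lt_iff_lt, Int.sign_mul_self_eq_abs]
      have := abs_pos.2 hw
      omega
    -- An arc of length two isolates the point `φ (i + 1)`: it can only be joined to its two
    -- neighbours, so it has exactly one triangle.
    by_cases hlast : N = 2
    · subst hlast
      push_cast at harc
      refine ⟨i + 1, ?_⟩
      have right (x) (hx : φ (i + 1) < x) (hj : T.Joined (φ (i + 1)) x) : x = φ (i + 2) := by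
        have hle : ¬ φ (i + 2) < x := fun hlt => by
          rcases hj with hj | hj
          · exact hj.2 (hφ (by omega)) hlt
          · exact T.compatible _ harc _ hj (Or.inl ⟨hφ (by omega), hφ (by omega), hlt⟩)
        refine le_antisymm (not_lt.1 hle) (not_lt.1 fun hlt => ?_)
        have := (hcov (i + 1)).2 hx
        rw [add_assoc] at this
        exact this hlt
      have left (x) (hx : x < φ (i + 1)) (hj : T.Joined x (φ (i + 1))) : x = φ i := by
        have hle : ¬ x < φ i := fun hlt => by
          rcases hj with hj | hj
          · exact hj.2 hlt (hφ (by omega))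
          · exact T.compatible _ harc _ hj (Or.inr ⟨hlt, hφ (by omega), hφ (by omega)⟩)
        exact le_antisymm (not_lt.1 fun hlt => (hcov i).2 hlt hx) (not_lt.1 hle)
      have : {t ∈ T.triangles | φ (i + 1) = t.1 ∨ φ (i + 1) = t.2.1 ∨ φ (i + 1) = t.2.2} =
          {(φ i, φ (i + 1), φ (i + 2))} := by
        ext ⟨p, q, r⟩
        simp only [Triangulation.triangles, Set.mem_ofPred_eq, Set.mem_singleton_iff]
        constructor
        · rintro ⟨⟨hpq, hqr, jpq, jqr, jpr⟩, rfl | rfl | rfl⟩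
          · have e1 := right _ hpq jpq
            have e2 := right _ (hpq.trans hqr) jpr
            exact absurd (e1.trans e2.symm) hqr.ne
          · rw [left _ hpq jpq, right _ hqr jqr]
          · have e1 := left _ hqr jqr
            have e2 := left _ (hpq.trans hqr) jpr
            exact absurd (e2.trans e1.symm) hpq.ne
        · rintro h
          simp only [Prod.mk.injEq] at h
          obtain ⟨rfl, rfl, rfl⟩ := h
          have := hcov (i + 1)
          rw [add_assoc] at this
          exact ⟨⟨hφ (by omega), hφ (by omega), Or.inl (hcov i), Or.inl this, Or.inr harc⟩,
            Or.inr (Or.inl rfl)⟩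
      rw [Triangulation.numTriangles, this, Set.encard_singleton]
    -- Either the short chord belongs to `T` by maximality, or some arc crosses it. The latter ends
    -- at `φ (i + 1)` and is confined by the given arc, so it is a shorter peripheral arc.
    · by_cases hcross : ∀ d ∈ T.arcs, ¬ Crosses (φ i, φ (i + 2)) d
      · refine ih 2 (by omega) i (T.maximal _ ⟨hφ (by omega), ?_, fun k => ?_⟩ hcross)
        · exact fun h => h.2 (c := φ (i + 1)) (hφ (by omega)) (hφ (by push_cast; omega))
        · have : |w| ≤ |k * w| ∨ k = 0 := by
            rcases eq_or_ne k 0 with rfl | hk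
            · simp
            · rw [abs_mul]
              exact Or.inl (le_mul_of_one_le_left (abs_nonneg w) (Int.one_le_abs hk))
          simp only [Crosses, deckChord, hdeck, hφ.lt_iff_lt]
          push_cast
          rcases this with h | rfl
          · rcases abs_cases (k * w) with ⟨h', -⟩ | ⟨h', -⟩ <;> omega
          · omega
      · push Not at hcross
        obtain ⟨⟨p, q⟩, hd, ⟨c1, c2, c3⟩ | ⟨c1, c2, c3⟩⟩ := hcross
        · obtain ⟨l, rfl⟩ := hconv _ _ _ c1 c2
          rw [hφ.lt_iff_lt] at c1 c2
          obtain rfl : l = i + 1 := by omega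
          have hq : q ≤ φ (i + N) := not_lt.1 fun hlt =>
            T.compatible _ harc _ hd (Or.inl ⟨hφ (by omega), hφ (by omega), hlt⟩)
          obtain ⟨l, rfl⟩ : ∃ l, q = φ l := by
            rcases hq.eq_or_lt with rfl | hq
            · exact ⟨_, rfl⟩
            · exact hconv _ _ _ c3 hq
          simp only [hφ.lt_iff_lt, hφ.le_iff_le] at c3 hq
          refine ih (l - (i + 1)).toNat (by omega) (i + 1) ?_
          rwa [Int.toNat_of_nonneg (by omega), add_sub_cancel]
        · obtain ⟨l, rfl⟩ := hconv _ _ _ c2 c3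
          simp only [hφ.lt_iff_lt] at c2 c3
          exact absurd (Or.inr ⟨c1, hφ c2, hφ (by omega)⟩)
            (T.compatible _ harc _ hd)

theorem Triangulation.exists_of_outer_mem (hm : 0 < m) {i j : ℤ}
    (h : (outer i, outer j) ∈ T.arcs) : ∃ l, T.numTriangles (outer l) = 1 := by
  have hlt := outer_lt_outer.1 (T.isArc _ h).1
  refine exists_numTriangles_eq_one (φ := outer) (w := m) (fun _ _ h => outer_lt_outer.2 h) ?_
    (by omega) (fun k i => rfl) (j - i).toNat i ?_
  · intro i j p _ h2
    rcases p.cases with h | ⟨l, rfl⟩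
    · exact h
    · simp at h2
  · rwa [Int.toNat_of_nonneg (by omega), add_sub_cancel]

/-- The upper side is numbered against the order of `CoverPoint`, so it is parametrized by `inner
(-i)`, and deck transformations shift by `-n`. -/
theorem Triangulation.exists_of_inner_mem (hn : 0 < n) {i j : ℤ}
    (h : (inner i, inner j) ∈ T.arcs) : ∃ l, T.numTriangles (inner l) = 1 := by
  have hlt := inner_lt_inner.1 (T.isArc _ h).1
  have hconv (i j : ℤ) (p : CoverPoint) (h1 : inner (-i) < p) (_ : p < inner (-j)) :
      ∃ l, p = inner (-l) := by
    rcases p.cases with ⟨l, rfl⟩ | ⟨l, rfl⟩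
    · simp at h1
    · exact ⟨-l, by simp⟩
  obtain ⟨l, hl⟩ := exists_numTriangles_eq_one (T := T) (φ := fun i => inner (-i)) (w := -n)
    (fun _ _ h => inner_lt_inner.2 (by omega)) hconv (by omega)
    (fun k i => by rw [deck_inner]; congr 1; ring) (i - j).toNat (-i)
    (by rw [Int.toNat_of_nonneg (by omega)]; simpa using h)
  exact ⟨_, hl⟩

/-- A triangulation without peripheral arcs is a ladder. -/
theorem Triangulation.exists_arcs_eq_ladder (hm : 0 < m) (hn : 0 < n)
    (ho : ∀ i j, (outer i, outer j) ∉ T.arcs) (hi : ∀ i j, (inner i, inner j) ∉ T.arcs) :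
    ∃ J : ℤ → ℤ, Monotone J ∧ (∀ i, J (i + m) = J i + n) ∧ T.arcs = ladder J := by
  let S : Set (ℤ × ℤ) := {x | (outer x.1, inner x.2) ∈ T.arcs}
  have arc_cases (d) (hd : d ∈ T.arcs) : ∃ i j, d = (outer i, inner j) ∧ (i, j) ∈ S := by
    obtain ⟨p, q⟩ := d
    rcases p.cases with ⟨i, rfl⟩ | ⟨i, rfl⟩ <;> rcases q.cases with ⟨j, rfl⟩ | ⟨j, rfl⟩
    · exact absurd hd (ho _ _)
    · exact ⟨i, j, rfl, hd⟩
    · simpa using (T.isArc _ hd).1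
    · exact absurd hd (hi _ _)
  have chain {i j i' j' : ℤ} (h : (i, j) ∈ S) (h' : (i', j') ∈ S) (hlt : i < i') : j ≤ j' := by
    have := T.compatible _ h _ h'
    rw [crosses_bridging] at this
    omega
  -- A pair weakly comparable with all bridging arcs is itself an arc: both coordinates move in the
  -- same direction under deck transformations, so it never crosses its translates.
  have maxl {i j : ℤ} (h : ∀ i' j', (i', j') ∈ S → (i' < i → j' ≤ j) ∧ (i < i' → j ≤ j')) :
      (i, j) ∈ S := by
    refine T.maximal _ ⟨by simp, by simp, fun k => ?_⟩ fun d hd => ?_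
    · simp only [deckChord, deck_outer, deck_inner, crosses_bridging]
      rintro (⟨h1, h2⟩ | ⟨h1, h2⟩)
      · have : 0 < k := by by_contra hk; nlinarith
        nlinarith
      · have : k < 0 := by by_contra hk; nlinarith
        nlinarith
    · obtain ⟨i', j', rfl, hS⟩ := arc_cases d hd
      have := h _ _ hS
      rw [crosses_bridging]
      omega
  have hdeck {i j : ℤ} (k : ℤ) (h : (i, j) ∈ S) : (i + k * m, j + k * n) ∈ S := T.deck_mem _ h k
  obtain ⟨i₀, j₀, h₀⟩ : ∃ i j, (i, j) ∈ S := by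
    by_contra hne
    push Not at hne
    exact hne 0 0 (maxl fun i j h => absurd h (hne i j))
  -- `J i` is the largest inner endpoint of an arc starting at or before `i`. Deck translates of one
  -- arc, moved past `i` on either side, supply the upper bound and the nonemptiness.
  have hJ (i : ℤ) : ∃ j : ℤ, (∃ i' ≤ i, (i', j) ∈ S) ∧
      ∀ j', (∃ i' ≤ i, (i', j') ∈ S) → j' ≤ j := by
    refine Int.exists_greatest_of_bdd (P := fun j => ∃ i' ≤ i, (i', j) ∈ S)
      ⟨j₀ + (|i| + |i₀| + 1) * n, ?_⟩
      ⟨j₀ + -(|i| + |i₀|) * n, i₀ + -(|i| + |i₀|) * m, ?_, hdeck _ h₀⟩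
    · rintro j ⟨i', hi', h⟩
      refine chain h (hdeck (|i| + |i₀| + 1) h₀) (hi'.trans_lt ?_)
      have := le_abs_self i
      have := neg_abs_le i₀
      have := abs_nonneg i
      have := abs_nonneg i₀
      nlinarith
    · have := neg_abs_le i
      have := le_abs_self i₀
      have := abs_nonneg i
      have := abs_nonneg i₀
      nlinarith
  choose J hJ1 hJ2 using hJ
  have below {i i' j : ℤ} (h : (i', j) ∈ S) (hle : i' ≤ i) : j ≤ J i := hJ2 i j ⟨i', hle, h⟩
  have above {i i' j : ℤ} (h : (i', j) ∈ S) (hlt : i < i') : J i ≤ j := by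
    obtain ⟨i'', hle, h''⟩ := hJ1 i
    exact chain h'' h (hle.trans_lt hlt)
  have hmem (i : ℤ) : (i, J i) ∈ S :=
    maxl fun i' j' h => ⟨fun hlt => below h hlt.le, fun hlt => above h hlt⟩
  refine ⟨J, fun i i' hle => below (hmem i) hle, fun i => le_antisymm ?_ ?_, ?_⟩
  · have := below (hdeck (-1) (hmem (i + m))) (i := i) (by simp)
    omega
  · have := below (hdeck 1 (hmem i)) (i := i + m) (by simp)
    omega
  · ext d
    constructor
    · intro hd
      obtain ⟨i, j, rfl, h⟩ := arc_cases d hd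
      exact mem_ladder.2 ⟨above h (by omega), below h le_rfl⟩
    · rintro ⟨i, j, rfl, h1, h2⟩
      refine maxl fun i' j' h => ⟨fun hlt => ?_, fun hlt => ?_⟩
      · exact (below h (by omega)).trans h1
      · exact h2.trans (above h hlt)

end Annulus

/-! ### Gluing triangles onto boundary segments -/

namespace Annulus

/-- An equivariant embedding `E` of marked points that leaves out the points `P k`, each of which
lies between the images of two neighbours `u k` and `w k`. -/
structure EarInsertion (m n n' : ℕ) where
  E : CoverPoint → CoverPoint
  P : ℤ → CoverPoint
  u : ℤ → CoverPoint
  w : ℤ → CoverPoint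
  strictMono : StrictMono E
  cases : ∀ x, (∃ y, x = E y) ∨ ∃ k, x = P k
  covBy : ∀ k, u k ⋖ w k
  left : ∀ k, E (u k) ⋖ P k
  right : ∀ k, P k ⋖ E (w k)
  u_injective : Function.Injective u
  deck_E : ∀ l x, deck m n' l (E x) = E (deck m n l x)
  deck_u : ∀ l k, deck m n l (u k) = u (k + l)
  deck_w : ∀ l k, deck m n l (w k) = w (k + l)

namespace EarInsertion

variable {m n n' : ℕ} (I : EarInsertion m n n')

theorem E_ne_P (x : CoverPoint) (k : ℤ) : I.E x ≠ I.P k := fun h => by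
  have h1 := (I.left k).1
  have h2 := (I.right k).1
  rw [← h, I.strictMono.lt_iff_lt] at h1 h2
  exact (I.covBy k).2 h1 h2

theorem E_covBy_E {x y : CoverPoint} :
    I.E x ⋖ I.E y ↔ x ⋖ y ∧ ∀ k, ¬ (x = I.u k ∧ y = I.w k) := by
  constructor
  · intro h
    refine ⟨⟨I.strictMono.lt_iff_lt.1 h.1, fun z h1 h2 => h.2 (I.strictMono h1) (I.strictMono h2)⟩,
      ?_⟩
    rintro k ⟨rfl, rfl⟩
    exact h.2 (I.left k).1 (I.right k).1
  · rintro ⟨h, hne⟩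
    refine ⟨I.strictMono h.1, fun z h1 h2 => ?_⟩
    rcases I.cases z with ⟨z, rfl⟩ | ⟨k, rfl⟩
    · exact h.2 (I.strictMono.lt_iff_lt.1 h1) (I.strictMono.lt_iff_lt.1 h2)
    · have hx : x ≤ I.u k := I.strictMono.le_iff_le.1 (not_lt.1 fun hlt => (I.left k).2 hlt h1)
      have hy : I.w k ≤ y := I.strictMono.le_iff_le.1 (not_lt.1 fun hlt => (I.right k).2 h2 hlt)
      have hlt := (I.covBy k).1
      refine hne k ⟨(hx.eq_of_not_lt fun hx' => h.2 hx' (hlt.trans_le hy)),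
        (hy.eq_of_not_lt fun hy' => h.2 (hx.trans_lt hlt) hy').symm⟩

theorem crosses_E {x y x' y' : CoverPoint} :
    Crosses (I.E x, I.E y) (I.E x', I.E y') ↔ Crosses (x, y) (x', y') := by
  simp [Crosses, I.strictMono.lt_iff_lt]

variable (T : Triangulation m n)

/-- The arcs before the insertion, and the arcs that cut off the new points. -/
def arcs : Set Chord :=
  {c | ∃ x y, c = (I.E x, I.E y) ∧ ((x, y) ∈ T.arcs ∨ ∃ k, x = I.u k ∧ y = I.w k)}

variable {T}

theorem E_mem_arcs {x y : CoverPoint} :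
    (I.E x, I.E y) ∈ I.arcs T ↔ (x, y) ∈ T.arcs ∨ ∃ k, x = I.u k ∧ y = I.w k := by
  constructor
  · rintro ⟨x', y', h, h'⟩
    simp only [Prod.mk.injEq, I.strictMono.injective.eq_iff] at h
    rwa [h.1, h.2]
  · exact fun h => ⟨x, y, rfl, h⟩

theorem ear_mem_arcs (k : ℤ) : (I.E (I.u k), I.E (I.w k)) ∈ I.arcs T :=
  I.E_mem_arcs.2 (Or.inr ⟨k, rfl, rfl⟩)

/-- No chord can end strictly between two neighbours. -/
theorem not_crosses_ear (x y : CoverPoint) (k : ℤ) : ¬ Crosses (x, y) (I.u k, I.w k) := by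
  rintro (⟨-, h1, h2⟩ | ⟨h1, h2, -⟩) <;> exact (I.covBy k).2 h1 h2

theorem arcs_not_crosses {c d : Chord} (hc : c ∈ I.arcs T) (hd : d ∈ I.arcs T) :
    ¬ Crosses c d := by
  obtain ⟨x, y, rfl, hc⟩ := hc
  obtain ⟨x', y', rfl, hd⟩ := hd
  rw [I.crosses_E]
  rcases hd with hd | ⟨k, rfl, rfl⟩
  · rcases hc with hc | ⟨k, rfl, rfl⟩
    · exact T.compatible _ hc _ hd
    · rw [crosses_comm]
      exact I.not_crosses_ear _ _ k
  · exact I.not_crosses_ear _ _ k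

theorem deckChord_mem_arcs {c : Chord} (hc : c ∈ I.arcs T) (l : ℤ) :
    deckChord m n' l c ∈ I.arcs T := by
  obtain ⟨x, y, rfl, hc⟩ := hc
  rw [deckChord, I.deck_E, I.deck_E, I.E_mem_arcs]
  rcases hc with hc | ⟨k, rfl, rfl⟩
  · exact Or.inl (T.deck_mem _ hc l)
  · exact Or.inr ⟨k + l, I.deck_u l k, I.deck_w l k⟩

variable (T) in
/-- The triangulation after the insertion of new marked points. -/
def triangulation : Triangulation m n' where
  arcs := I.arcs T
  isArc c hc := by
    have hself := fun l => I.arcs_not_crosses hc (I.deckChord_mem_arcs hc l)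
    obtain ⟨x, y, rfl, hc⟩ := hc
    refine ⟨?_, ?_, hself⟩
    · rcases hc with hc | ⟨k, rfl, rfl⟩
      · exact I.strictMono (T.isArc _ hc).1
      · exact I.strictMono (I.covBy k).1
    · rw [I.E_covBy_E]
      rintro ⟨h1, h2⟩
      rcases hc with hc | ⟨k, h⟩
      · exact (T.isArc _ hc).2.1 h1
      · exact h2 k h
  deck_mem _ hc := I.deckChord_mem_arcs hc
  compatible _ hc _ hd := I.arcs_not_crosses hc hd
  maximal := by
    rintro ⟨p, q⟩ ⟨h1, h2, h3⟩ h
    simp only at h1 h2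
    rcases I.cases p with ⟨x, rfl⟩ | ⟨k, rfl⟩
    · rcases I.cases q with ⟨y, rfl⟩ | ⟨k, rfl⟩
      · rw [I.E_mem_arcs]
        by_cases hxy : x ⋖ y
        · rw [I.E_covBy_E] at h2
          push Not at h2
          exact Or.inr (h2 hxy)
        · refine Or.inl (T.maximal _ ⟨I.strictMono.lt_iff_lt.1 h1, hxy, fun l hl => h3 l ?_⟩ ?_)
          · rw [deckChord, I.deck_E, I.deck_E]
            exact I.crosses_E.2 hl
          · rintro ⟨x', y'⟩ hd hcross
            exact h _ (I.E_mem_arcs.2 (Or.inl hd)) (I.crosses_E.2 hcross)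
      -- A chord ending at a new point is a boundary segment or crosses the arc cutting off that
      -- point.
      · have hle : I.E x ≤ I.E (I.u k) := not_lt.1 fun hlt => (I.left k).2 hlt h1
        have hne : I.E x ≠ I.E (I.u k) := fun he => h2 (he ▸ I.left k)
        exact absurd (Or.inl ⟨lt_of_le_of_ne hle hne, (I.left k).1, (I.right k).1⟩)
          (h _ (I.ear_mem_arcs k))
    · have hle : I.E (I.w k) ≤ q := not_lt.1 fun hlt => (I.right k).2 h1 hlt
      have hne : I.E (I.w k) ≠ q := fun he => h2 (he ▸ I.right k)
      exact absurd (Or.inr ⟨(I.left k).1, (I.right k).1, lt_of_le_of_ne hle hne⟩)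
        (h _ (I.ear_mem_arcs k))

/-- A boundary segment that receives an ear turns into an arc, so the relation of being joined is
unchanged. -/
theorem joined_E {x y : CoverPoint} :
    (I.triangulation T).Joined (I.E x) (I.E y) ↔ T.Joined x y := by
  unfold Triangulation.Joined
  rw [I.E_covBy_E]
  change _ ∨ _ ∈ I.arcs T ↔ _
  rw [I.E_mem_arcs]
  constructor
  · rintro (⟨h, -⟩ | h | ⟨k, rfl, rfl⟩)
    · exact Or.inl h
    · exact Or.inr h
    · exact Or.inl (I.covBy k)
  · rintro (h | h)
    · by_cases hk : ∃ k, x = I.u k ∧ y = I.w k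
      · exact Or.inr (Or.inr hk)
      · exact Or.inl ⟨h, not_exists.1 hk⟩
    · exact Or.inr (Or.inl h)

theorem joined_P_left {k : ℤ} {y : CoverPoint} :
    (I.triangulation T).Joined (I.P k) y ↔ y = I.E (I.w k) := by
  constructor
  · rintro (h | ⟨x, y, h, -⟩)
    · exact h.unique_right (I.right k)
    · exact absurd (Prod.ext_iff.1 h).1.symm (I.E_ne_P x k)
  · rintro rfl
    exact Or.inl (I.right k)

theorem joined_P_right {k : ℤ} {x : CoverPoint} :
    (I.triangulation T).Joined x (I.P k) ↔ x = I.E (I.u k) := by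
  constructor
  · rintro (h | ⟨x, y, h, -⟩)
    · exact h.unique_left (I.left k)
    · exact absurd (Prod.ext_iff.1 h).2.symm (I.E_ne_P y k)
  · rintro rfl
    exact Or.inl (I.left k)

/-- The triangle cut off at a new point. -/
def ear (k : ℤ) : CoverPoint × CoverPoint × CoverPoint := (I.E (I.u k), I.P k, I.E (I.w k))

/-- The image of a triangle. -/
def mapTriangle (t : CoverPoint × CoverPoint × CoverPoint) : CoverPoint × CoverPoint × CoverPoint :=
  (I.E t.1, I.E t.2.1, I.E t.2.2)

theorem mapTriangle_injective : Function.Injective I.mapTriangle := by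
  rintro ⟨x, y, z⟩ ⟨x', y', z'⟩ h
  simpa [mapTriangle, I.strictMono.injective.eq_iff] using h

theorem ear_injective : Function.Injective I.ear := fun _ _ h =>
  I.u_injective (I.strictMono.injective (Prod.ext_iff.1 h).1)

theorem mapTriangle_ne_ear (t : CoverPoint × CoverPoint × CoverPoint) (k : ℤ) :
    I.mapTriangle t ≠ I.ear k := fun h => I.E_ne_P _ k (Prod.ext_iff.1 (Prod.ext_iff.1 h).2).1

theorem mapTriangle_mem {t : CoverPoint × CoverPoint × CoverPoint} :
    I.mapTriangle t ∈ (I.triangulation T).triangles ↔ t ∈ T.triangles := by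
  simp [Triangulation.triangles, mapTriangle, I.joined_E, I.strictMono.lt_iff_lt]

theorem ear_mem (k : ℤ) : I.ear k ∈ (I.triangulation T).triangles :=
  ⟨(I.left k).1, (I.right k).1, I.joined_P_right.2 rfl, I.joined_P_left.2 rfl,
    I.joined_E.2 (Or.inl (I.covBy k))⟩

theorem triangle_cases {t : CoverPoint × CoverPoint × CoverPoint}
    (ht : t ∈ (I.triangulation T).triangles) :
    (∃ t', t = I.mapTriangle t' ∧ t' ∈ T.triangles) ∨ ∃ k, t = I.ear k := by
  have ht' := ht
  obtain ⟨p, q, r⟩ := t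
  obtain ⟨hpq, hqr, jpq, jqr, jpr⟩ := ht
  simp only at hpq hqr jpq jqr jpr
  rcases I.cases p with ⟨x, rfl⟩ | ⟨k, rfl⟩
  · rcases I.cases q with ⟨y, rfl⟩ | ⟨k, rfl⟩
    · rcases I.cases r with ⟨z, rfl⟩ | ⟨k, rfl⟩
      · exact Or.inl ⟨(x, y, z), rfl, I.mapTriangle_mem.1 ht'⟩
      · rw [I.joined_P_right] at jqr jpr
        exact absurd (jpr.trans jqr.symm) hpq.ne
    · rw [I.joined_P_right] at jpq
      rw [I.joined_P_left] at jqr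
      exact Or.inr ⟨k, by rw [jpq, jqr, ear]⟩
  · rw [I.joined_P_left] at jpq jpr
    exact absurd (jpq.trans jpr.symm) hqr.ne

theorem numTriangles_P (k : ℤ) : (I.triangulation T).numTriangles (I.P k) = 1 := by
  rw [Triangulation.numTriangles, Set.encard_eq_one]
  refine ⟨I.ear k, Set.eq_singleton_iff_unique_mem.2 ⟨⟨I.ear_mem k, Or.inr (Or.inl rfl)⟩, ?_⟩⟩
  rintro t ⟨ht, h⟩
  rcases I.triangle_cases ht with ⟨t', rfl, -⟩ | ⟨k', rfl⟩
  · rcases h with h | h | h <;> exact absurd h.symm (I.E_ne_P _ k)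
  · rcases h with h | h | h
    · exact absurd h.symm (I.E_ne_P _ k)
    · have h' := I.left k
      rw [h] at h'
      rw [I.u_injective (I.strictMono.injective (h'.unique_left (I.left k')))]
    · exact absurd h.symm (I.E_ne_P _ k)

/-- Besides the images of the old triangles there is one new triangle for each ear whose base ends
at the point. -/
theorem numTriangles_E (x : CoverPoint) : (I.triangulation T).numTriangles (I.E x) =
    T.numTriangles x + {k | x = I.u k ∨ x = I.w k}.encard := by
  rw [Triangulation.numTriangles, Triangulation.numTriangles,
    ← I.mapTriangle_injective.encard_image {t ∈ T.triangles | x = t.1 ∨ x = t.2.1 ∨ x = t.2.2},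
    ← I.ear_injective.encard_image, ← Set.encard_union_eq]
  · congr 1
    have hinj {y : CoverPoint} : I.E x = I.E y ↔ x = y := I.strictMono.injective.eq_iff
    ext t
    constructor
    · rintro ⟨ht, h⟩
      rcases I.triangle_cases ht with ⟨t', rfl, ht'⟩ | ⟨k, rfl⟩
      · simp only [mapTriangle, hinj] at h
        exact Or.inl ⟨t', ⟨ht', h⟩, rfl⟩
      · simp only [ear, hinj, I.E_ne_P, false_or] at h
        exact Or.inr ⟨k, h, rfl⟩
    · rintro (⟨t', ⟨ht', h⟩, rfl⟩ | ⟨k, h, rfl⟩)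
      · refine ⟨I.mapTriangle_mem.2 ht', ?_⟩
        simpa only [mapTriangle, hinj] using h
      · refine ⟨I.ear_mem k, ?_⟩
        simp only [ear, hinj, I.E_ne_P, false_or]
        exact h
  · rw [Set.disjoint_left]
    rintro _ ⟨t, -, rfl⟩ ⟨k, -, h⟩
    exact I.mapTriangle_ne_ear t k h.symm

end EarInsertion

/-- The embedding of marked points that makes room for one new point in each period of length `n`
on the upper side. -/
def stretch (n : ℕ) (s : ℤ) (p : CoverPoint) : CoverPoint :=
  match ofLex p with
  | Sum.inl i => outer i
  | Sum.inr j => inner (OrderDual.ofDual j + (OrderDual.ofDual j + s) / n)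

@[simp] theorem stretch_outer (n : ℕ) (s i : ℤ) : stretch n s (outer i) = outer i := rfl

theorem stretch_inner (n : ℕ) (s j : ℤ) :
    stretch n s (inner j) = inner (j + (j + s) / n) := rfl

theorem stretch_inner_mul_add {n : ℕ} (s k : ℤ) {r : ℤ} (h0 : 0 ≤ r) (hr : r < n) :
    stretch n s (inner (n * k + r - s)) = inner ((n + 1) * k + r - s) := by
  have : (r + n * k) / n = k := by
    rw [Int.add_mul_ediv_left _ _ (by omega), Int.ediv_eq_zero_of_lt h0 hr, zero_add]
  rw [stretch_inner, sub_add_cancel, add_comm _ r, this]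
  congr 1; ring

theorem stretch_strictMono {n : ℕ} (hn : 0 < n) (s : ℤ) : StrictMono (stretch n s) := by
  intro p q h
  rcases p.cases with ⟨i, rfl⟩ | ⟨i, rfl⟩ <;> rcases q.cases with ⟨j, rfl⟩ | ⟨j, rfl⟩
  · simpa using h
  · simp [stretch_inner]
  · simp at h
  · rw [inner_lt_inner] at h
    simp only [stretch_inner, inner_lt_inner]
    have := Int.ediv_le_ediv (show (0 : ℤ) < n by omega) (show j + s ≤ i + s by omega)
    omega

/-- The insertion of one new point in each period on the upper side. -/
def innerInsertion (m : ℕ) {n : ℕ} (hn : 0 < n) (s : ℤ) : EarInsertion m n (n + 1) where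
  E := stretch n s
  P k := inner ((n + 1) * k + n - s)
  -- The order decreases along the upper side, so the predecessor `u k` is the first point of the
  -- next period and `w k` the last one of period `k`. The summands `0` and `n - 1` are the
  -- remainders used by `stretch_inner_mul_add`.
  u k := inner (n * (k + 1) + 0 - s)
  w k := inner (n * k + (n - 1) - s)
  strictMono := stretch_strictMono hn s
  cases x := by
    rcases x.cases with ⟨i, rfl⟩ | ⟨t, rfl⟩
    · exact Or.inl ⟨outer i, rfl⟩
    · obtain ⟨k, r, hr, ht⟩ := exists_mul_add n (t + s)
      obtain rfl : t = (n + 1) * k + r - s := by omega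
      rcases hr.eq_or_lt with rfl | hr
      · exact Or.inr ⟨k, rfl⟩
      · exact Or.inl ⟨_, (stretch_inner_mul_add s k (by omega) (by omega)).symm⟩
  covBy k := by
    rw [inner_covBy_inner]; ring
  left k := by
    rw [stretch_inner_mul_add _ _ (by omega) (by omega), inner_covBy_inner]; ring
  right k := by
    rw [stretch_inner_mul_add _ _ (by omega) (by omega), inner_covBy_inner]; ring
  u_injective k k' h := by
    have hn' : (n : ℤ) ≠ 0 := by omega
    rw [inner_inj, sub_left_inj, add_left_inj] at h
    linarith [mul_left_cancel₀ hn' h]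
  deck_E l x := by
    rcases x.cases with ⟨i, rfl⟩ | ⟨j, rfl⟩
    · simp
    · have : (j + l * n + s) / n = (j + s) / n + l := by
        rw [add_right_comm, Int.add_mul_ediv_right _ _ (by omega)]
      simp only [stretch_inner, deck_inner, this]
      congr 1; push_cast; ring
  deck_u l k := by
    rw [deck_inner]; congr 1; ring
  deck_w l k := by
    rw [deck_inner]; congr 1; ring

/-- The sequence `a` of numbers of triangles on the outer boundary can be realized together with
`b` and all its shifts on the inner boundary with `n` marked points. -/
def IsPartner (a : ℤ → ℕ) (n : ℕ) (b : ℤ → ℕ) : Prop :=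
  ∀ s : ℤ, ∃ (m : ℕ) (_ : 0 < m) (T : Triangulation m n),
    (∀ i, T.numTriangles (outer i) = a i) ∧ ∀ j, T.numTriangles (inner j) = b (j + s)

/-- Quantifying over all shifts in `IsPartner` provides the invariance that `IsReduction.induct`
requires. -/
theorem IsPartner.shift {a b : ℤ → ℕ} {n : ℕ} (h : IsPartner a n b) (s : ℤ) :
    IsPartner a n fun i => b (i + s) := fun t => by
  simpa only [add_assoc] using h (t + s)

theorem IsPartner.insertion {a b c : ℤ → ℕ} {n : ℕ} (hn : 0 < n) (hc : IsInsertion n b c)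
    (h : IsPartner a n b) : IsPartner a (n + 1) c := by
  intro s
  obtain ⟨m, hm, T, ho, hi⟩ := h s
  set I := innerInsertion m hn s with hI
  refine ⟨m, hm, I.triangulation T, fun i => ?_, fun t => ?_⟩
  · have := I.numTriangles_E (T := T) (outer i)
    simpa [hI, innerInsertion, ho] using this
  · obtain ⟨k, r, hr, ht⟩ := exists_mul_add n (t + s)
    obtain rfl : t = (n + 1) * k + r - s := by omega
    rcases hr.eq_or_lt with rfl | hr
    · rw [sub_add_cancel, hc.1]
      exact I.numTriangles_P (T := T) k
    · have := I.numTriangles_E (T := T) (inner (n * k + r - s))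
      -- Ear `k - 1` touches the first point of period `k` and ear `k` the last; for `n = 1` the
      -- same point meets both, and the two indices still differ.
      have hset : {k' | inner (n * k + r - s) = I.u k' ∨ inner (n * k + r - s) = I.w k'} =
          (if r = 0 then {k - 1} else ∅) ∪ if r + 1 = n then {k} else ∅ := by
        ext k'
        have hu : inner (n * k + r - s) = I.u k' ↔ r = 0 ∧ k' = k - 1 := by
          rw [hI, innerInsertion, inner_inj]
          constructor
          · intro h
            have h1 : (k - (k' + 1)) * n = -r := by linarith
            have h2 : k - (k' + 1) = 0 := by
              by_contra hne
              rcases lt_or_gt_of_ne hne with hlt | hlt <;> nlinarith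
            rw [h2] at h1
            omega
          · rintro ⟨rfl, rfl⟩
            push_cast; ring
        have hw : inner (n * k + r - s) = I.w k' ↔ r + 1 = n ∧ k' = k := by
          rw [hI, innerInsertion, inner_inj]
          constructor
          · intro h
            have h1 : (k - k') * n = n - 1 - r := by linarith
            have h2 : k - k' = 0 := by
              by_contra hne
              rcases lt_or_gt_of_ne hne with hlt | hlt <;> nlinarith
            rw [h2] at h1
            omega
          · rintro ⟨rfl, rfl⟩
            push_cast; ring
        have hite (p : Prop) [Decidable p] (x : ℤ) :
            k' ∈ (if p then {x} else ∅ : Set ℤ) ↔ p ∧ k' = x := by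
          split_ifs <;> simp [*]
        rw [Set.mem_ofPred_eq, hu, hw, Set.mem_union, hite, hite]
      rw [hset, hi, show I.E = stretch n s from rfl,
        stretch_inner_mul_add s k (by omega) (by omega)] at this
      rw [this, sub_add_cancel, sub_add_cancel, hc.2 k r hr, Set.encard_union_eq]
      · split_ifs <;> simp [one_add_one_eq_two]
      · split_ifs <;> simp

end Annulus

/-! ### Staircase functions and their adjoints -/

open PeriodicFrieze Annulus

theorem eq_apply_zero_of_succ {α : Type*} {f : ℤ → α} (h : ∀ i, f (i + 1) = f i) (i : ℤ) :
    f i = f 0 := by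
  have : Function.Periodic f 1 := h
  simpa using this.int_mul_eq i

theorem Monotone.succ_eq_of_periodic {f : ℤ → ℤ} (hf : Monotone f) {n : ℕ} (hn : 0 < n)
    (h : ∀ i, f (i + n) = f i) (i : ℤ) : f (i + 1) = f i :=
  le_antisymm ((hf (by omega)).trans_eq (h i)) (hf (by omega))

/-- A discrete antiderivative on `ℤ`: at every index at least one of the two sums is empty. -/
theorem exists_sub_eq (f : ℤ → ℤ) : ∃ J : ℤ → ℤ, ∀ i, J i - J (i - 1) = f i := by
  refine ⟨fun i => ∑ k ∈ Finset.Ioc 0 i, f k - ∑ k ∈ Finset.Ioc i 0, f k, fun i => ?_⟩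
  rcases lt_or_ge 0 i with hi | hi
  · have h1 : Finset.Ioc 0 i = insert i (Finset.Ioc 0 (i - 1)) := by
      ext k; simp only [Finset.mem_Ioc, Finset.mem_insert]; omega
    have h2 : Finset.Ioc i 0 = ∅ := Finset.Ioc_eq_empty (by omega)
    have h3 : Finset.Ioc (i - 1) 0 = ∅ := Finset.Ioc_eq_empty (by omega)
    simp only [h1, h2, h3]
    rw [Finset.sum_insert (by simp)]
    simp
  · have h1 : Finset.Ioc (i - 1) 0 = insert i (Finset.Ioc i 0) := by
      ext k; simp only [Finset.mem_Ioc, Finset.mem_insert]; omega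
    have h2 : Finset.Ioc 0 i = ∅ := Finset.Ioc_eq_empty (by omega)
    have h3 : Finset.Ioc 0 (i - 1) = ∅ := Finset.Ioc_eq_empty (by omega)
    simp only [h1, h2, h3]
    rw [Finset.sum_insert (by simp)]
    simp

/-- As `n > 0`, quasi-periodicity makes `J` unbounded in both directions, so a least `i` with `j ≤ J
i` exists. -/
theorem Monotone.exists_galoisConnection {J : ℤ → ℤ} (hJ : Monotone J) {m n : ℕ} (hn : 0 < n)
    (hper : ∀ i, J (i + m) = J i + n) : ∃ L, GaloisConnection L J := by
  have hpos (j : ℤ) : j ≤ J (|j - J 0| * m) := by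
    have h := apply_add_mul hper 0 |j - J 0|
    rw [zero_add] at h
    have := le_abs_self (j - J 0)
    have := abs_nonneg (j - J 0)
    nlinarith
  have hneg (j : ℤ) : J (-(|j - J 0| + 1) * m) < j := by
    have h := apply_add_mul hper 0 (-(|j - J 0| + 1))
    rw [zero_add] at h
    have := neg_abs_le (j - J 0)
    have := abs_nonneg (j - J 0)
    nlinarith
  have hL (j : ℤ) : ∃ i, j ≤ J i ∧ ∀ i', j ≤ J i' → i ≤ i' :=
    Int.exists_least_of_bdd
      ⟨_, fun i hi => le_of_not_gt fun hlt => (hi.trans (hJ hlt.le)).not_gt (hneg j)⟩ ⟨_, hpos j⟩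
  choose L hL1 hL2 using hL
  exact ⟨L, fun j i => ⟨fun h => (hL1 j).trans (hJ h), hL2 j i⟩⟩

namespace GaloisConnection

variable {L J : ℤ → ℤ}

theorem l_add_of_u_add (hG : GaloisConnection L J) {m n : ℤ} (h : ∀ i, J (i + m) = J i + n)
    (j : ℤ) :
    L (j + n) = L j + m := by
  refine eq_of_forall_ge_iff fun i => ?_
  have := h (i - m)
  rw [sub_add_cancel] at this
  rw [hG, this, add_le_add_iff_right, ← hG, le_sub_iff_add_le]

theorem u_add_of_l_add (hG : GaloisConnection L J) {m n : ℤ} (h : ∀ j, L (j + n) = L j + m)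
    (i : ℤ) :
    J (i + m) = J i + n := by
  refine eq_of_forall_le_iff fun j => ?_
  have := h (j - n)
  rw [sub_add_cancel] at this
  rw [← hG, this, add_le_add_iff_right, hG, sub_le_iff_le_add]

/-- If `L` were constant, `J (L 0)` would bound every integer from above. Hence the partner row is
not constantly `2`. -/
theorem not_forall_l_succ_eq (hG : GaloisConnection L J) : ¬ ∀ j, L (j + 1) = L j := fun h => by
  have h1 := (hG (J (L 0) + 1) (L 0)).1
  rw [eq_apply_zero_of_succ h (J (L 0) + 1)] at h1
  have := h1 le_rfl
  omega

end GaloisConnection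

/-- The quiddity row `2 + (L (j + 1) - L j)` on the upper side of a ladder. -/
def upperRow (L : ℤ → ℤ) (j : ℤ) : ℕ := 2 + (L (j + 1) - L j).toNat

theorem upperRow_eq_two_iff {L : ℤ → ℤ} (hL : Monotone L) {j : ℤ} :
    upperRow L j = 2 ↔ L (j + 1) = L j := by
  have := hL (show j ≤ j + 1 by omega)
  unfold upperRow
  omega

/-- The increments of `L` are `n`-periodic, so `L (j + n) - L j` is constant; were it zero, the
monotone `L` would be periodic and hence constant. -/
theorem exists_period_of_upperRow {L : ℤ → ℤ} (hL : Monotone L)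
    (hne : ¬ ∀ j, L (j + 1) = L j) {n : ℕ} (hn : 0 < n)
    (h : ∀ j, upperRow L (j + n) = upperRow L j) :
    ∃ m : ℕ, 0 < m ∧ ∀ j, L (j + n) = L j + m := by
  have hconst := eq_apply_zero_of_succ (f := fun j => L (j + n) - L j) fun j => by
    have h0 := h j
    have h1 := hL (show j ≤ j + 1 by omega)
    have h2 := hL (show j + n ≤ j + n + 1 by omega)
    unfold upperRow at h0
    rw [add_right_comm j 1 (n : ℤ)]
    omega
  have h0 := hL (show (0 : ℤ) ≤ 0 + n by omega)
  refine ⟨(L (0 + n) - L 0).toNat, Nat.pos_of_ne_zero fun hz => hne ?_, fun j => ?_⟩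
  · refine hL.succ_eq_of_periodic hn fun i => ?_
    have : L (i + n) - L i = L (0 + n) - L 0 := hconst i
    omega
  · have : L (j + n) - L j = L (0 + n) - L 0 := hconst j
    omega

/-! ### Skeletal friezes and their partners -/

namespace PeriodicFrieze

theorem isQuidditySequence_iff {F : PeriodicFrieze} {q : List ℕ} : F.IsQuidditySequence q ↔
    ∃ n : ℕ, 0 < n ∧ (∀ i, F.quiddityRow (i + n) = F.quiddityRow i) ∧
      ∃ s : ℤ, q = (List.range n).map fun k : ℕ => F.quiddityRow (s + k) := by
  simp [IsQuidditySequence, ← List.map_eq_flatMap, Function.comp_def]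

theorem IsSkeletal.two_le {F : PeriodicFrieze} (hF : F.IsSkeletal) (i : ℤ) :
    2 ≤ F.quiddityRow i := by
  have h1 := F.entry_pos 2 i (by omega)
  have h2 := hF.1 i
  unfold quiddityRow at *
  omega

/-- The quiddity row of a skeletal frieze is the sequence of numbers of triangles on the lower
side of a ladder. -/
theorem IsSkeletal.exists_ladder {F : PeriodicFrieze} (hF : F.IsSkeletal) :
    ∃ (J L : ℤ → ℤ) (m n : ℕ), 0 < m ∧ 0 < n ∧ GaloisConnection L J ∧
      (∀ i, J (i + m) = J i + n) ∧ ∀ i, F.quiddityRow i = 2 + (J i - J (i - 1)).toNat := by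
  obtain ⟨J, hJ⟩ := exists_sub_eq fun i => F.quiddityRow i - 2
  have htwo := hF.two_le
  have mono : Monotone J := monotone_int_of_le_succ fun i => by
    have h1 := hJ (i + 1)
    have h2 := htwo (i + 1)
    rw [add_sub_cancel_right] at h1
    omega
  obtain ⟨m, hm, hper⟩ := F.periodic
  have hrow (i : ℤ) : F.quiddityRow i = upperRow J (i - 1) := by
    have h1 := hJ i
    have h2 := htwo i
    unfold upperRow
    rw [sub_add_cancel]
    omega
  obtain ⟨n, hn, hJn⟩ := exists_period_of_upperRow mono (n := m) (fun hall => by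
    obtain ⟨i, hi⟩ := hF.2
    exact hi ((hrow i).trans ((upperRow_eq_two_iff mono).2 (hall _)))) hm fun j => by
      have h1 := hrow (j + 1 + m)
      rw [quiddityRow, hper, ← quiddityRow, hrow, show j + 1 + m - 1 = j + m by ring,
        add_sub_cancel_right] at h1
      exact h1.symm
  obtain ⟨L, hG⟩ := mono.exists_galoisConnection hn hJn
  refine ⟨J, L, m, n, hm, hn, hG, hJn, fun i => ?_⟩
  rw [hrow, upperRow, sub_add_cancel]

end PeriodicFrieze

theorem isFriezePair_of_ladder {J L : ℤ → ℤ} (hG : GaloisConnection L J) {m n : ℕ} (hm : 0 < m)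
    (hn : 0 < n) (hJ : ∀ i, J (i + m) = J i + n) {F₁ F₂ : PeriodicFrieze}
    (h₁ : ∀ i, F₁.quiddityRow i = 2 + (J i - J (i - 1)).toNat)
    (h₂ : F₂.quiddityRow = upperRow L) : IsFriezePair F₁ F₂ :=
  ⟨m, n, hm, hn, Triangulation.ofLadder hG hJ,
    fun i => by rw [numTriangles_outer_of_ladder rfl hG.monotone_u, h₁],
    fun j => by rw [numTriangles_inner_of_ladder rfl hG, h₂, upperRow]⟩

/-- A skeletal frieze that forms a pair with another one is determined by it up to translation. -/
theorem translate_of_isFriezePair {J L : ℤ → ℤ} (hG : GaloisConnection L J)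
    {F₁ F₂ G : PeriodicFrieze} (hF₁ : F₁.IsSkeletal) (hskel : G.IsSkeletal)
    (h₁ : ∀ i, F₁.quiddityRow i = 2 + (J i - J (i - 1)).toNat)
    (h₂ : F₂.quiddityRow = upperRow L) (hpair : IsFriezePair F₁ G) : F₂.Translate G := by
  obtain ⟨m, n, hm, hn, T, ho, hi⟩ := hpair
  obtain ⟨J', mono, hper, hT⟩ := T.exists_arcs_eq_ladder hm hn
    (fun i j h => by
      obtain ⟨l, hl⟩ := T.exists_of_outer_mem hm h
      rw [ho] at hl
      exact hF₁.1 l (by exact_mod_cast hl))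
    (fun i j h => by
      obtain ⟨l, hl⟩ := T.exists_of_inner_mem hn h
      rw [hi] at hl
      exact hskel.1 l (by exact_mod_cast hl))
  obtain ⟨L', hG'⟩ := mono.exists_galoisConnection hn hper
  -- Equal outer counts mean equal increments, so `J'` and `J` differ by a constant `d`, and the
  -- adjoints by a shift of the argument.
  have hconst := eq_apply_zero_of_succ (f := fun i => J' i - J i) fun i => by
    have h0 := ho (i + 1)
    rw [numTriangles_outer_of_ladder hT mono, h₁, Nat.cast_inj, add_sub_cancel_right] at h0
    have h1 := mono (show i ≤ i + 1 by omega)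
    have h2 := hG.monotone_u (show i ≤ i + 1 by omega)
    omega
  set d := J' 0 - J 0
  have hL (j : ℤ) : L' j = L (j + -d) := by
    refine eq_of_forall_ge_iff fun i => ?_
    have : J' i - J i = d := hconst i
    rw [hG', hG]
    omega
  refine translate_of_quiddityRow_eq (s := -d) fun j => ?_
  have h0 := hi j
  rw [numTriangles_inner_of_ladder hT hG', Nat.cast_inj, hL, hL] at h0
  rw [← h0, h₂, upperRow, add_right_comm]

/-- Reverse reductions of the partner of a frieze are partners as well. -/
theorem isFriezePair_of_isReverseReductionOf {J L : ℤ → ℤ} (hG : GaloisConnection L J)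
    {F₁ F₂ G : PeriodicFrieze} (h₁ : ∀ i, F₁.quiddityRow i = 2 + (J i - J (i - 1)).toNat)
    (h₂ : F₂.quiddityRow = upperRow L) (hred : G.IsReverseReductionOf F₂) :
    IsFriezePair F₁ G := by
  obtain ⟨q, p, hGq, hFp, htrans⟩ := hred
  obtain ⟨n', hn', hGper, t, hq⟩ := isQuidditySequence_iff.1 hGq
  obtain ⟨n, hn, hFper, s, hp⟩ := isQuidditySequence_iff.1 hFp
  rw [h₂] at hFper hp
  obtain ⟨m, hm, hLper⟩ :=
    exists_period_of_upperRow hG.monotone_l hG.not_forall_l_succ_eq hn hFper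
  -- Shifting the argument of `L` lowers the adjoint `J` by `s`, which does not affect the outer
  -- counts.
  have hpartner : IsPartner F₁.quiddityRow n (upperRow L) := fun s => by
    have hG' : GaloisConnection (fun j => L (j + s)) fun i => J i - s := fun j i => by
      rw [hG, le_sub_iff_add_le]
    refine ⟨m, hm, Triangulation.ofLadder (n := n) hG' fun i => ?_, fun i => ?_, fun j => ?_⟩
    · rw [hG.u_add_of_l_add hLper]; ring
    · rw [numTriangles_outer_of_ladder rfl hG'.monotone_u, h₁]
      simp
    · rw [numTriangles_inner_of_ladder rfl hG', upperRow, add_right_comm]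
  have hperp : p.periodicExt = fun j => upperRow L (j + s) := by
    funext j
    rw [hp, add_comm j s]
    exact List.periodicExt_map_range (f := fun j => upperRow L (s + j)) hn
      (fun j => by rw [← add_assoc, hFper]) j
  have hperq (j : ℤ) : q.periodicExt j = G.quiddityRow (t + j) := by
    rw [hq]
    exact List.periodicExt_map_range (f := fun j => G.quiddityRow (t + j)) hn'
      (fun j => by rw [← add_assoc, hGper]) j
  have hmain : IsPartner F₁.quiddityRow q.length q.periodicExt := by
    refine IsReduction.transGen_induct (Φ := IsPartner F₁.quiddityRow)
      (fun _ _ s h => h.shift s) (fun _ _ _ hn hc h => h.insertion hn hc) htrans ?_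
    rw [hperp, show p.length = n by simp [hp]]
    exact hpartner.shift s
  -- The shift by `-t` undoes the starting position of the quiddity sequence `q`.
  obtain ⟨m', hm', T, ho, hi⟩ := hmain (-t)
  refine ⟨m', q.length, hm', by simpa [hq] using hn', T, ho, fun j => ?_⟩
  rw [hi, hperq, add_neg_cancel_comm_assoc]

/-! ### Infinitely many reverse reductions -/

theorem PeriodicFrieze.finite_range_quiddityRow (F : PeriodicFrieze) :
    (Set.range F.quiddityRow).Finite := by
  obtain ⟨n, hn, hper⟩ := F.periodic
  have : Function.Periodic F.quiddityRow (n : ℤ) := hper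
  refine ((Set.finite_Ico 0 (n : ℤ)).image F.quiddityRow).subset ?_
  rintro _ ⟨i, rfl⟩
  obtain ⟨j, hj, h⟩ := this.exists_mem_Ico₀ (by omega) i
  exact ⟨j, hj, h.symm⟩

/-- Iterated reverse reductions make an entry as large as one wants. -/
theorem exists_transGen_isReduction {x y : ℕ} (hx : 1 ≤ x) (hy : 1 ≤ y) (l : List ℕ) (t : ℕ) :
    ∃ (y' : ℕ) (l' : List ℕ), 1 ≤ y' ∧
      Relation.TransGen IsReduction ((x + t + 1) :: y' :: l') (x :: y :: l) := by
  -- Each new `1` goes directly behind the first entry, which therefore grows by one every time.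
  have step {x y : ℕ} (hx : 1 ≤ x) (hy : 1 ≤ y) (l : List ℕ) :
      IsReduction ((x + 1) :: 1 :: (y + 1) :: l) (x :: y :: l) :=
    Or.inl ⟨x + 1, y + 1, l, by omega, by omega, List.IsRotated.refl _, List.IsRotated.refl _⟩
  induction t with
  | zero => exact ⟨1, _, le_rfl, .single (step hx hy l)⟩
  | succ t ih =>
    obtain ⟨y', l', hy', h⟩ := ih
    exact ⟨1, _, le_rfl, .head (step (by omega) hy' l') h⟩

theorem exists_isReverseReductionOf {L : ℤ → ℤ} {m n : ℕ} (hn : 0 < n)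
    (hL : ∀ j, L (j + n) = L j + m) {F : PeriodicFrieze} (hF : F.quiddityRow = upperRow L)
    (t : ℕ) : ∃ G : PeriodicFrieze, G.IsReverseReductionOf F ∧
      G.quiddityRow 0 = upperRow L 0 + t + 1 := by
  have hper (j : ℤ) : upperRow L (j + n) = upperRow L j := by
    unfold upperRow
    rw [add_right_comm, hL, hL, add_sub_add_right_eq_sub]
  have hper2 (j : ℤ) : upperRow L (j + (n + n : ℕ)) = upperRow L j := by
    push_cast
    rw [← add_assoc, hper, hper]
  set p := (List.range (n + n)).map fun k : ℕ => upperRow L k with hp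
  -- The doubled period guarantees two entries, even for `n = 1`.
  have hpF : F.IsQuidditySequence p :=
    isQuidditySequence_iff.2 ⟨n + n, by omega, by rwa [hF], 0, by simp [hF, hp]⟩
  obtain ⟨N, hN⟩ := Nat.exists_eq_add_of_le' (show 2 ≤ n + n by omega)
  have hp' : p = upperRow L 0 :: upperRow L 1 ::
      (List.range N).map fun k : ℕ => upperRow L (k + 2 : ℕ) := by
    rw [hp, hN, List.range_succ_eq_map, List.range_succ_eq_map]
    simp [Function.comp_def, add_assoc, one_add_one_eq_two]
  have one_le (j : ℤ) : 1 ≤ upperRow L j := by unfold upperRow; omega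
  obtain ⟨y, l, -, hred⟩ := exists_transGen_isReduction (one_le 0) (one_le 1)
    ((List.range N).map fun k : ℕ => upperRow L (k + 2 : ℕ)) t
  rw [← hp'] at hred
  set q := (upperRow L 0 + t + 1) :: y :: l with hq
  have hsuper : ∃ v, IsSupersolution q.periodicExt v := by
    refine IsReduction.transGen_induct (Φ := fun _ b => ∃ v, IsSupersolution b v)
      (fun _ b s ⟨v, hv, hv'⟩ => ⟨fun i => v (i + s), fun i => hv _, fun i => ?_⟩)
      (fun _ _ _ hn hc h => IsSupersolution.exists_of_isInsertion hn hc h) hred ?_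
    · simpa only [sub_add_eq_add_sub, add_right_comm] using hv' (i + s)
    -- All entries of the partner row are at least `2`, so the constant `1` is a supersolution to
    -- start from.
    · refine ⟨fun _ => 1, fun _ => one_pos, fun i => ?_⟩
      have := List.periodicExt_map_range (f := upperRow L) (by omega) hper2 i
      rw [hp, this, upperRow]
      push_cast
      omega
  obtain ⟨v, hv⟩ := hsuper
  obtain ⟨G, hGq⟩ := exists_of_isSupersolution (n := q.length) (by simp [hq])
    q.periodicExt_add_length hv
  have hget {r : ℕ} (hr : r < q.length) : q.periodicExt r = q[r] := by
    simpa using q.periodicExt_mul_add 0 hr rfl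
  refine ⟨G, ⟨q, p, isQuidditySequence_iff.2 ⟨q.length, by simp [hq], ?_, 0, ?_⟩, hpF, hred⟩,
    ?_⟩
  · rw [hGq]
    exact q.periodicExt_add_length
  · refine List.ext_getElem (by simp) fun r hr _ => ?_
    simp [hGq, hget hr]
  · rw [hGq]
    exact hget (r := 0) (by simp [hq])

/-- The set of values of a quiddity row is finite and invariant under translation; finitely many
classes could not account for all the values `a + t + 1`. -/
theorem infinite_isReverseReductionOf {F : PeriodicFrieze} {a : ℕ}
    (h : ∀ t, ∃ G : PeriodicFrieze, G.IsReverseReductionOf F ∧ G.quiddityRow 0 = a + t + 1) :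
    (Quotient.mk PeriodicFrieze.translateSetoid ''
      {G : PeriodicFrieze | G.IsReverseReductionOf F}).Infinite := by
  intro hfin
  have hinj : Function.Injective fun t => a + t + 1 := fun t t' h => by simpa using h
  refine Set.infinite_range_of_injective hinj
    ((hfin.biUnion fun c _ => c.out.finite_range_quiddityRow).subset ?_)
  rintro _ ⟨t, rfl⟩
  obtain ⟨G, hG, hG0⟩ := h t
  refine Set.mem_biUnion ⟨G, hG, rfl⟩ ?_
  obtain ⟨s, hs⟩ : PeriodicFrieze.Translate
    (Quotient.mk PeriodicFrieze.translateSetoid G).out G := 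
    Quotient.exact (Quotient.out_eq (Quotient.mk PeriodicFrieze.translateSetoid G))
  exact ⟨0 + s, (hs 2 0).symm.trans hG0⟩

theorem theoremA (F₁ : PeriodicFrieze) (hF₁ : F₁.IsSkeletal) :
    ∃ F₂ : PeriodicFrieze, F₂.IsSkeletal ∧ Annulus.IsFriezePair F₁ F₂ ∧
      -- the skeletal partner is unique, up to translation
      (∀ G : PeriodicFrieze, G.IsSkeletal → Annulus.IsFriezePair F₁ G → F₂.Translate G) ∧
      -- every frieze obtained from the partner by reverse reductions forms a pair with `F₁`
      (∀ G : PeriodicFrieze, G.IsReverseReductionOf F₂ → Annulus.IsFriezePair F₁ G) ∧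
      -- up to translation, there are infinitely many such friezes
      (Quotient.mk PeriodicFrieze.translateSetoid ''
        {G : PeriodicFrieze | G.IsReverseReductionOf F₂}).Infinite := by
  obtain ⟨J, L, m, n, hm, hn, hG, hJ, h₁⟩ := hF₁.exists_ladder
  have hL := hG.l_add_of_u_add hJ
  have htwo (j : ℤ) : 2 ≤ upperRow L j := Nat.le_add_right _ _
  obtain ⟨F₂, h₂⟩ := exists_of_isSupersolution (a := upperRow L) (v := fun _ => 1) hn
    (fun j => by unfold upperRow; rw [add_right_comm, hL, hL, add_sub_add_right_eq_sub])
    ⟨fun _ => one_pos, fun j => by have := htwo j; push_cast; omega⟩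
  refine ⟨F₂, ⟨fun j => ?_, ?_⟩, isFriezePair_of_ladder hG hm hn hJ h₁ h₂,
    fun G hskel => translate_of_isFriezePair hG hF₁ hskel h₁ h₂,
    fun G => isFriezePair_of_isReverseReductionOf hG h₁ h₂,
    infinite_isReverseReductionOf (exists_isReverseReductionOf hn hL h₂)⟩
  · have := htwo j
    rw [h₂]
    omega
  · by_contra hall
    push Not at hall
    refine hG.not_forall_l_succ_eq fun j => (upperRow_eq_two_iff hG.monotone_l).1 ?_
    rw [← h₂, hall]
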